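/- Conventions. $\mathbb C^n$ carries the Euclidean norm, $B(a,r)$ is the open ball, and for an open set $D\subset\mathbb C^n$ we write $\delta_D(z)=d(z,\partial D)$. A *domain* is a nonempty connected open set. A domain $\Omega$ is *pseudoconvex* if $-\log\delta_\Omega$ is plurisubharmonic (psh) on $\Omega$. A bounded domain $\Omega$ is *hyperconvex* if there is a negative continuous psh function $\rho$ on $\Omega$ such that $\{z\in\Omega:\rho(z)<-c\}$ is relatively compact in $\Omega$ for every $c>0$. For $a\in\partial\Omega$ and $0<\beta\le 1$ we say that $\partial\Omega$ is *a Hölder graph of order $\beta$ near $a$* if there are $r>0$, a unit vector $v\in\mathbb C^n=\mathbb R^{2n}$ and a function $g$, Hölder continuous of order $\beta$ on the ball of radius $r$ about $0$ in the real hyperplane $v^\perp$, such that $\partial\Omega\cap B(a,r)$ consists of the points $z=a+x+s v\in B(a,r)$ with $x\in v^\perp$, $s\in\mathbb R$ and $s=g(x)$. The boundary $\partial\Omega$ is *Hölder* if near each of its points it is a Hölder graph of some order in $(0,1]$. Theorem. Let $\Omega\subset\mathbb C^n$ be a bounded pseudoconvex domain with Hölder boundary. Then $\Omega$ is hyperconvex.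 Moreover, let $a\in\partial\Omega$ and $0<\beta\le1$ be such that $\partial\Omega$ is a Hölder graph of order $\beta$ near $a$. Then there is $R>0$ such that for every $0<r<R$ and every real $\tau<\frac{\beta}{1-\beta}$ (every real $\tau$ if $\beta=1$) there are a negative continuous psh function $\rho$ on $D:=\Omega\cap B(a,r)$ and constants $C>0$, $0<\varepsilon<1$ with $$-\rho(z)\le C\,\bigl(-\log\delta_D(z)\bigr)^{-\tau}\qquad\text{for all } z\in D \text{ with } \delta_D(z)<\varepsilon .$$ -/

import Mathlib

open scoped NNReal

noncomputable section

namespace HolderHyperconvex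

/-- Complex Euclidean space `ℂⁿ`. -/
abbrev Cn (n : ℕ) := EuclideanSpace ℂ (Fin n)

/-- The boundary distance `δ_Ω(z) = d(z, ∂Ω)`. -/
def bdryDist {n : ℕ} (Ω : Set (Cn n)) (z : Cn n) : ℝ :=
  Metric.infDist z (frontier Ω)

/-- `u` is a continuous (real-valued) plurisubharmonic function on the open set `Ω`: it is
continuous on `Ω` and has the sub-mean value property on every closed affine complex disc
contained in `Ω`. -/
def ContPSHOn {n : ℕ} (u : Cn n → ℝ) (Ω : Set (Cn n)) : Prop :=
  ContinuousOn u Ω ∧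
    ∀ z w : Cn n, (∀ ζ : ℂ, ‖ζ‖ ≤ 1 → z + ζ • w ∈ Ω) →
      u z ≤ Real.circleAverage (fun ζ : ℂ => u (z + ζ • w)) 0 1

/-- Bounded domain: a bounded, nonempty, connected open set. -/
def IsBoundedDomain {n : ℕ} (Ω : Set (Cn n)) : Prop :=
  IsOpen Ω ∧ IsConnected Ω ∧ Bornology.IsBounded Ω

/-- (Hartogs) pseudoconvexity: `-log δ_Ω` is plurisubharmonic on `Ω`. -/
def IsPseudoconvex {n : ℕ} (Ω : Set (Cn n)) : Prop :=
  ContPSHOn (fun z => -Real.log (bdryDist Ω z)) Ω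

/-- Hyperconvexity: there is a negative continuous psh function `ρ` on `Ω` with
`{ρ < -c}` relatively compact in `Ω` for every `c > 0`. -/
def IsHyperconvex {n : ℕ} (Ω : Set (Cn n)) : Prop :=
  ∃ ρ : Cn n → ℝ, ContPSHOn ρ Ω ∧ (∀ z ∈ Ω, ρ z < 0) ∧
    ∀ c : ℝ, 0 < c →
      IsCompact (closure {z ∈ Ω | ρ z < -c}) ∧ closure {z ∈ Ω | ρ z < -c} ⊆ Ω

/-- The height of `z` in the direction of the unit vector `v`, i.e. the real scalar product of
`v` and `z` in `ℂⁿ = ℝ²ⁿ`. For `v = i eₙ` this is `Im zₙ`. -/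
def height {n : ℕ} (v z : Cn n) : ℝ := (inner ℂ v z).re

/-- The orthogonal projection of `z` to the real hyperplane `{height v = 0}` (`v` a unit vector).
For `v = i eₙ` this is `(z', Re zₙ)`. -/
def horiz {n : ℕ} (v z : Cn n) : Cn n := z - (height v z : ℂ) • v

/-- Near the point `a`, the boundary of `Ω` is the graph, in some real direction `v`, of a
function `g` that is Hölder continuous of order `β` on a ball of the real hyperplane
orthogonal to `v`. -/
def IsHolderGraphAt {n : ℕ} (Ω : Set (Cn n)) (a : Cn n) (β : ℝ≥0) : Prop :=
  ∃ (v : Cn n) (r : ℝ) (C : ℝ≥0) (g : Cn n → ℝ), ‖v‖ = 1 ∧ 0 < r ∧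
    HolderOnWith C β g {x | x ∈ Metric.ball 0 r ∧ height v x = 0} ∧
    ∀ z ∈ Metric.ball a r, (z ∈ frontier Ω ↔ height v (z - a) = g (horiz v (z - a)))

/-- Hölder boundary: near each of its points the boundary is the graph of a Hölder continuous
function (of some order in `(0, 1]`, which may depend on the point). -/
def HasHolderBoundary {n : ℕ} (Ω : Set (Cn n)) : Prop :=
  ∀ a ∈ frontier Ω, ∃ β : ℝ≥0, 0 < β ∧ β ≤ 1 ∧ IsHolderGraphAt Ω a β

end HolderHyperconvex

end

open scoped NNReal

noncomputable section

namespace HolderHyperconvex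

open Metric Real

variable {n : ℕ}

/-! ### Subharmonic functions on the disc -/


/-! Near a Hölder boundary point of order β, a step of length t along ±v keeps points inside Ω and
leaves them at boundary distance at least const · t ^ (1/β) (`exists_inward_direction`). The
direction is locally constant, so pseudoconvexity makes ψ(z) = -log δ(z + t e(z)) psh. Let L = -log
t. Then β ψ ≤ L + O(1) everywhere, β ψ ≥ β L - O(1) where δ ≤ t, and β ψ ≤ β L / Λ + O(1) where δ ≥
t ^ (1/Λ).

Subtracting a constant L + O(1) and normalizing yields a negative psh function that is ≤ -1 on the
inner set and ≥ -q on the outer collar, as soon as (1 - β) / (1 - β/Λ) < q, with L large enough to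
absorb the bounded errors. For τ (1 - β) < β this is possible with q = Λ ^ (-τ) and Λ slightly above
1 (`exists_ratio`). With levels -log t_k = l Λ ^ k, gluing the functions scaled by q ^ k
(`exists_psh_of_levels`) gives a psh function ≥ -q ^ k on {δ ≤ t_k}, and q ^ k = (Λ ^ k) ^ (-τ) is
comparable to (-log δ) ^ (-τ). This is `exists_local_psh`; a maximum with the barrier |z - a|² - r²
then treats small balls.

Hyperconvexity follows from these local functions (`isHyperconvex_of_local`). Different local
functions need not be comparable, but suitable sums of N truncations of them differ by at most 2,
uniformly in N. Bounded affine corrections therefore suffice to glue them over a finite cover, and a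
large N makes the corrections negligible after normalization (`exists_psh_separating`). Gluing over
levels with q = 1/2 finishes. -/

lemma circleAverage_re_of_differentiable {F : ℂ → ℂ} (hF : Differentiable ℂ F) (c : ℂ) (R : ℝ) :
    circleAverage (fun ζ => (F ζ).re) c R = (F c).re := by
  have h1 : circleAverage F c R = F c := (hF.diffContOnCl).circleAverage
  have h2 : CircleIntegrable F c R := hF.continuous.continuousOn.circleIntegrable'
  have h3 := Complex.reCLM.circleAverage_comp_comm h2
  rw [h1] at h3
  exact h3

/-- On the unit circle a monomial of negative frequency is the conjugate of a power of ζ.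
Conjugation does not affect real parts, so trigonometric polynomials supply harmonic approximants
without solving a Dirichlet problem. -/
lemma exists_entire_of_mem_span_fourier {h : C(AddCircle (2 * π), ℂ)}
    (hh : h ∈ Submodule.span ℂ (Set.range (@fourier (2 * π)))) :
    ∃ F₁ F₂ : ℂ → ℂ, Differentiable ℂ F₁ ∧ Differentiable ℂ F₂ ∧
      ∀ x : ℝ, h (x : AddCircle (2 * π)) =
        F₁ (Complex.exp (x * Complex.I)) + (starRingEnd ℂ) (F₂ (Complex.exp (x * Complex.I))) := by
  induction hh using Submodule.span_induction with
  | mem h hh =>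
    obtain ⟨n, rfl⟩ := hh
    have key : ∀ x : ℝ, fourier n (x : AddCircle (2 * π)) = Complex.exp (x * Complex.I) ^ n := by
      intro x
      rw [fourier_coe_apply, ← Complex.exp_int_mul]
      congr 1
      have : (π : ℂ) ≠ 0 := by exact_mod_cast Real.pi_ne_zero
      push_cast
      field_simp
    obtain ⟨m, rfl | rfl⟩ := n.eq_nat_or_neg
    · refine ⟨fun ζ => ζ ^ m, fun _ => 0, by fun_prop, by fun_prop, fun x => ?_⟩
      rw [key]; simp
    · refine ⟨fun _ => 0, fun ζ => ζ ^ m, by fun_prop, by fun_prop, fun x => ?_⟩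
      rw [key]
      simp only [zpow_neg, zpow_natCast, map_pow, zero_add, ← inv_pow]
      congr 1
      rw [← Complex.exp_conj, ← Complex.exp_neg]
      simp
  | zero => exact ⟨fun _ => 0, fun _ => 0, by fun_prop, by fun_prop, fun x => by simp⟩
  | add h₁ h₂ _ _ ih₁ ih₂ =>
    obtain ⟨F₁, F₂, d1, d2, e1⟩ := ih₁
    obtain ⟨G₁, G₂, d3, d4, e2⟩ := ih₂
    refine ⟨fun ζ => F₁ ζ + G₁ ζ, fun ζ => F₂ ζ + G₂ ζ, d1.add d3, d2.add d4, fun x => ?_⟩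
    simp only [ContinuousMap.add_apply, e1, e2, map_add]
    ring
  | smul c h₁ _ ih =>
    obtain ⟨F₁, F₂, d1, d2, e1⟩ := ih
    refine ⟨fun ζ => c * F₁ ζ, fun ζ => (starRingEnd ℂ) c * F₂ ζ, d1.const_mul _, d2.const_mul _,
      fun x => ?_⟩
    simp only [ContinuousMap.smul_apply, e1, map_mul, smul_eq_mul, Complex.conj_conj]
    ring

/-- A continuous function on the unit circle is a uniform limit of real parts of entire
functions. -/
lemma exists_entire_re_near {f : ℂ → ℝ} (hf : ContinuousOn f (sphere 0 1)) {e : ℝ} (he : 0 < e) :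
    ∃ F : ℂ → ℂ, Differentiable ℂ F ∧ ∀ ζ ∈ sphere (0 : ℂ) 1, |f ζ - (F ζ).re| ≤ e := by
  have : Fact (0 < 2 * π) := ⟨by positivity⟩
  have hc : Continuous fun x : AddCircle (2 * π) => ((f (AddCircle.toCircle x) : ℝ) : ℂ) := by
    refine Complex.continuous_ofReal.comp (hf.comp_continuous ?_ ?_)
    · exact continuous_subtype_val.comp AddCircle.continuous_toCircle
    · intro x; exact (AddCircle.toCircle x).2
  let h : C(AddCircle (2 * π), ℂ) := ⟨_, hc⟩
  have hmem : h ∈ (Submodule.span ℂ (Set.range (@fourier (2 * π)))).topologicalClosure := by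
    rw [span_fourier_closure_eq_top]; trivial
  obtain ⟨k, hk, hd⟩ := Metric.mem_closure_iff.1 hmem e he
  obtain ⟨F₁, F₂, d1, d2, e1⟩ := exists_entire_of_mem_span_fourier hk
  refine ⟨fun ζ => F₁ ζ + F₂ ζ, d1.add d2, fun ζ hζ => ?_⟩
  have hx : Complex.exp (ζ.arg * Complex.I) = ζ := by
    have := Complex.norm_mul_exp_arg_mul_I ζ
    rw [mem_sphere_zero_iff_norm] at hζ
    simpa [hζ] using this
  have h1 : ‖h (ζ.arg : AddCircle (2 * π)) - k (ζ.arg : AddCircle (2 * π))‖ ≤ e := by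
    rw [← dist_eq_norm]
    exact (ContinuousMap.dist_apply_le_dist _).trans hd.le
  have h2 : h (ζ.arg : AddCircle (2 * π)) = (f ζ : ℂ) := by
    show ((f (AddCircle.toCircle (ζ.arg : AddCircle (2 * π))) : ℝ) : ℂ) = _
    rw [AddCircle.toCircle_apply_mk]
    congr 2
    rw [Circle.coe_exp]
    convert hx using 3
    push_cast
    have : (π : ℂ) ≠ 0 := by exact_mod_cast Real.pi_ne_zero
    field_simp
  rw [h2, e1, hx] at h1
  have h3 := (Complex.abs_re_le_norm _).trans h1
  simpa using h3

/-- A continuous function on the closed disc that has the sub-mean value property on small circles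
has it on the unit circle. -/
lemma le_circleAverage_of_local {f : ℂ → ℝ} (hf : ContinuousOn f (closedBall 0 1))
    (h : ∀ c ∈ ball (0 : ℂ) 1, ∃ ε > 0, ∀ r, 0 < r → r < ε → f c ≤ circleAverage f c r) :
    f 0 ≤ circleAverage f 0 1 := by
  have hfs : ContinuousOn f (sphere 0 1) := hf.mono sphere_subset_closedBall
  have hfi : CircleIntegrable f 0 1 := hfs.circleIntegrable zero_le_one
  refine le_of_forall_pos_le_add fun e' he' => ?_
  obtain ⟨e, he, rfl⟩ : ∃ e > 0, e' = 3 * e := ⟨e' / 3, by positivity, by ring⟩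
  obtain ⟨F, hF, hFe⟩ := exists_entire_re_near hfs he
  have hFc : Continuous fun ζ => (F ζ).re := Complex.continuous_re.comp hF.continuous
  -- Adding e |ζ|² makes the difference strictly subharmonic, which excludes an interior maximum; on
  -- the circle f - Re F is within e of 0.
  let W : ℂ → ℝ := fun ζ => f ζ - (F ζ).re + e * ‖ζ‖ ^ 2
  have hW : ContinuousOn W (closedBall 0 1) :=
    (hf.sub hFc.continuousOn).add (by fun_prop)
  obtain ⟨ζ₀, hζ₀, hmax⟩ := (isCompact_closedBall (0 : ℂ) 1).exists_isMaxOn ⟨0, by simp⟩ hW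
  have hmax' : ∀ ζ ∈ closedBall (0 : ℂ) 1, W ζ ≤ W ζ₀ := fun ζ hζ => hmax hζ
  by_cases hb : ‖ζ₀‖ < 1
  · exfalso
    obtain ⟨ε, hε, hs⟩ := h ζ₀ (by simpa using hb)
    obtain ⟨r, hr0, hr⟩ := exists_between (lt_min hε (sub_pos.2 hb))
    have hr1 : r < ε := hr.trans_le (min_le_left _ _)
    have hr2 : r < 1 - ‖ζ₀‖ := hr.trans_le (min_le_right _ _)
    have hsub : sphere ζ₀ r ⊆ closedBall (0 : ℂ) 1 := by
      intro ζ hζ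
      rw [mem_sphere_iff_norm] at hζ
      rw [mem_closedBall_zero_iff]
      have := norm_add_le ζ₀ (ζ - ζ₀)
      simp only [add_sub_cancel] at this
      linarith
    have hfi' : CircleIntegrable f ζ₀ r := (hf.mono hsub).circleIntegrable hr0.le
    -- On the circle of radius r about ζ₀, |ζ|² = 2 Re(conj ζ₀ · ζ) - |ζ₀|² + r². The linear part is
    -- absorbed into H, and the gain e r² contradicts maximality.
    let H : ℂ → ℂ := fun ζ => F ζ - e * (2 * (starRingEnd ℂ) ζ₀ * ζ)
    have hH : Differentiable ℂ H := by
      unfold H; fun_prop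
    have hHi : CircleIntegrable (fun ζ => (H ζ).re) ζ₀ r :=
      (Complex.continuous_re.comp hH.continuous).continuousOn.circleIntegrable'
    have h1 : circleAverage (fun ζ => f ζ - (H ζ).re) ζ₀ r ≤ W ζ₀ + e * ‖ζ₀‖ ^ 2 - e * r ^ 2 := by
      refine circleAverage_mono_on_of_le_circle (hfi'.sub hHi) fun ζ hζ => ?_
      rw [abs_of_pos hr0] at hζ
      have h2 := hmax' ζ (hsub hζ)
      rw [mem_sphere_iff_norm] at hζ
      have h3 : ‖ζ - ζ₀‖ ^ 2 = ‖ζ‖ ^ 2 - 2 * ((starRingEnd ℂ) ζ₀ * ζ).re + ‖ζ₀‖ ^ 2 := by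
        simp only [Complex.sq_norm, Complex.normSq_apply, Complex.sub_re, Complex.sub_im,
          Complex.mul_re, Complex.conj_re, Complex.conj_im]
        ring
      have h4 : (H ζ).re = (F ζ).re - e * (2 * ((starRingEnd ℂ) ζ₀ * ζ).re) := by
        simp [H, mul_assoc]
      rw [h4]
      rw [hζ] at h3
      simp only [W] at h2 ⊢
      have := congrArg (e * ·) h3
      nlinarith
    rw [circleAverage_fun_sub hfi' hHi, circleAverage_re_of_differentiable hH] at h1
    have h5 := hs r hr0 hr1
    have h4 : (H ζ₀).re = (F ζ₀).re - e * (2 * ‖ζ₀‖ ^ 2) := by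
      have : ((starRingEnd ℂ) ζ₀ * ζ₀).re = ‖ζ₀‖ ^ 2 := by
        rw [Complex.sq_norm, Complex.normSq_apply]; simp
      rw [← this]; simp [H, mul_assoc]
    rw [h4] at h1
    simp only [W] at h1
    have : 0 < e * r ^ 2 := by positivity
    nlinarith
  · have hn : ‖ζ₀‖ = 1 := le_antisymm (by simpa using hζ₀) (not_lt.1 hb)
    have h1 := hmax' 0 (by simp)
    have h2 := (abs_le.1 (hFe ζ₀ (by simpa using hn))).2
    simp only [W, hn, norm_zero] at h1
    have h3 : (F 0).re ≤ circleAverage f 0 1 + e := by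
      rw [← circleAverage_re_of_differentiable hF 0 1, ← circleAverage_const e (0 : ℂ) 1,
        ← circleAverage_fun_add hfi (circleIntegrable_const _ _ _)]
      refine circleAverage_mono hFc.continuousOn.circleIntegrable'
        (hfi.add (circleIntegrable_const _ _ _)) fun ζ hζ => ?_
      have := (abs_le.1 (hFe ζ (by simpa using hζ))).1
      linarith
    linarith

/-! ### Continuous plurisubharmonic functions -/


lemma circleIntegrable_disc {u : Cn n → ℝ} {Ω : Set (Cn n)} (hu : ContinuousOn u Ω) {z w : Cn n}
    (h : ∀ ζ : ℂ, ‖ζ‖ ≤ 1 → z + ζ • w ∈ Ω) :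
    CircleIntegrable (fun ζ : ℂ => u (z + ζ • w)) 0 1 := by
  refine ContinuousOn.circleIntegrable zero_le_one (hu.comp (by fun_prop) fun ζ hζ => h ζ ?_)
  rw [mem_sphere_zero_iff_norm] at hζ
  exact hζ.le

/-- Continuity together with the sub-mean value property on small affine complex discs. -/
def LocPSHOn (u : Cn n → ℝ) (Ω : Set (Cn n)) : Prop :=
  ContinuousOn u Ω ∧ ∀ z ∈ Ω, ∃ ε > 0, ∀ w : Cn n, ‖w‖ < ε →
    u z ≤ circleAverage (fun ζ : ℂ => u (z + ζ • w)) 0 1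

lemma LocPSHOn.contPSHOn {u : Cn n → ℝ} {Ω : Set (Cn n)} (hu : LocPSHOn u Ω) : ContPSHOn u Ω := by
  refine ⟨hu.1, fun z w hzw => ?_⟩
  have hc : ContinuousOn (fun ζ : ℂ => u (z + ζ • w)) (closedBall 0 1) :=
    hu.1.comp (by fun_prop) fun ζ hζ => hzw ζ (by simpa using hζ)
  have := le_circleAverage_of_local hc fun c hc => ?_
  · simpa using this
  · obtain ⟨ε, hε, h⟩ := hu.2 (z + c • w) (hzw c (by simpa using (mem_ball_zero_iff.1 hc).le))
    refine ⟨ε / (‖w‖ + 1), by positivity, fun r hr0 hr => ?_⟩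
    have h1 := h ((r : ℂ) • w) (by
      rw [norm_smul, Complex.norm_real, norm_of_nonneg hr0.le]
      have h2 : r * (‖w‖ + 1) < ε := (lt_div_iff₀ (by positivity)).1 hr
      nlinarith [norm_nonneg w])
    rw [circleAverage_eq_circleAverage_zero_one]
    refine h1.trans_eq ?_
    congr 1
    funext ζ
    congr 1
    module

lemma exists_disc_subset {Ω : Set (Cn n)} (hΩ : IsOpen Ω) {z : Cn n} (hz : z ∈ Ω) :
    ∃ ε > 0, ∀ w : Cn n, ‖w‖ < ε → ∀ ζ : ℂ, ‖ζ‖ ≤ 1 → z + ζ • w ∈ Ω := by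
  obtain ⟨ε, hε, h⟩ := Metric.isOpen_iff.1 hΩ z hz
  refine ⟨ε, hε, fun w hw ζ hζ => h ?_⟩
  rw [mem_ball_iff_norm, add_sub_cancel_left, norm_smul]
  nlinarith [norm_nonneg w]

/-- Plurisubharmonicity is local: it suffices that near each point `u` equals a plurisubharmonic
function, or dominates one with equality at the point. -/
lemma contPSHOn_of_locally {u : Cn n → ℝ} {Ω : Set (Cn n)} (hc : ContinuousOn u Ω)
    (h : ∀ z ∈ Ω, ∃ (N : Set (Cn n)) (f : Cn n → ℝ), IsOpen N ∧ z ∈ N ∧ N ⊆ Ω ∧ ContPSHOn f N ∧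
      u z = f z ∧ ∀ y ∈ N, f y ≤ u y) : ContPSHOn u Ω := by
  refine LocPSHOn.contPSHOn ⟨hc, fun z hz => ?_⟩
  obtain ⟨N, f, hN, hzN, hNΩ, hf, hzf, hfu⟩ := h z hz
  obtain ⟨ε, hε, hd⟩ := exists_disc_subset hN hzN
  refine ⟨ε, hε, fun w hw => ?_⟩
  rw [hzf]
  refine (hf.2 z w (hd w hw)).trans (circleAverage_mono (circleIntegrable_disc hf.1 (hd w hw))
    (circleIntegrable_disc hc fun ζ hζ => hNΩ (hd w hw ζ hζ)) fun ζ hζ => hfu _ (hd w hw ζ ?_))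
  simpa using (mem_sphere_iff_norm.1 hζ).le

/-- A function that near each point equals a plurisubharmonic function is plurisubharmonic. -/
lemma contPSHOn_of_locally_eq {u : Cn n → ℝ} {Ω : Set (Cn n)}
    (h : ∀ z ∈ Ω, ∃ (N : Set (Cn n)) (f : Cn n → ℝ), IsOpen N ∧ z ∈ N ∧ N ⊆ Ω ∧ ContPSHOn f N ∧
      ∀ y ∈ N, u y = f y) : ContPSHOn u Ω := by
  refine contPSHOn_of_locally (fun z hz => ?_) fun z hz => ?_
  · obtain ⟨N, f, hN, hzN, -, hf, hfu⟩ := h z hz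
    have h1 : ContinuousAt f z := hf.1.continuousAt (hN.mem_nhds hzN)
    refine (h1.congr ?_).continuousWithinAt
    filter_upwards [hN.mem_nhds hzN] with y hy using (hfu y hy).symm
  · obtain ⟨N, f, hN, hzN, hNΩ, hf, hfu⟩ := h z hz
    exact ⟨N, f, hN, hzN, hNΩ, hf, hfu z hzN, fun y hy => (hfu y hy).ge⟩

namespace ContPSHOn

variable {u v : Cn n → ℝ} {Ω Ω' : Set (Cn n)}

lemma mono (hu : ContPSHOn u Ω) (h : Ω' ⊆ Ω) : ContPSHOn u Ω' :=
  ⟨hu.1.mono h, fun z w hd => hu.2 z w fun ζ hζ => h (hd ζ hζ)⟩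

lemma congr (hu : ContPSHOn u Ω) (h : ∀ z ∈ Ω, v z = u z) : ContPSHOn v Ω := by
  refine ⟨hu.1.congr h, fun z w hd => ?_⟩
  have h0 : z ∈ Ω := by simpa using hd 0 (by simp)
  rw [h z h0]
  refine (hu.2 z w hd).trans_eq (circleAverage_congr_sphere fun ζ hζ => (h _ (hd ζ ?_)).symm)
  simpa using (mem_sphere_iff_norm.1 hζ).le

lemma const (c : ℝ) : ContPSHOn (fun _ : Cn n => c) Ω :=
  ⟨continuousOn_const, fun _ _ _ => (circleAverage_const _ _ _).ge⟩

lemma add (hu : ContPSHOn u Ω) (hv : ContPSHOn v Ω) : ContPSHOn (fun z => u z + v z) Ω := by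
  refine ⟨hu.1.add hv.1, fun z w hd => ?_⟩
  rw [circleAverage_fun_add (circleIntegrable_disc hu.1 hd) (circleIntegrable_disc hv.1 hd)]
  exact add_le_add (hu.2 z w hd) (hv.2 z w hd)

lemma const_mul (hu : ContPSHOn u Ω) {c : ℝ} (hc : 0 ≤ c) : ContPSHOn (fun z => c * u z) Ω := by
  refine ⟨continuousOn_const.mul hu.1, fun z w hd => ?_⟩
  have := circleAverage_fun_smul (a := c) (f := fun ζ : ℂ => u (z + ζ • w)) (c := 0) (R := 1)
  simp only [smul_eq_mul] at this
  rw [this]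
  exact mul_le_mul_of_nonneg_left (hu.2 z w hd) hc

lemma max (hu : ContPSHOn u Ω) (hv : ContPSHOn v Ω) :
    ContPSHOn (fun z => Max.max (u z) (v z)) Ω := by
  have hc : ContinuousOn (fun z => Max.max (u z) (v z)) Ω := hu.1.sup hv.1
  refine ⟨hc, fun z w hd => max_le ?_ ?_⟩
  · exact (hu.2 z w hd).trans (circleAverage_mono (circleIntegrable_disc hu.1 hd)
      (circleIntegrable_disc hc hd) fun ζ _ => le_max_left _ _)
  · exact (hv.2 z w hd).trans (circleAverage_mono (circleIntegrable_disc hv.1 hd)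
      (circleIntegrable_disc hc hd) fun ζ _ => le_max_right _ _)

lemma sum {ι : Type*} (s : Finset ι) {f : ι → Cn n → ℝ} (hf : ∀ i ∈ s, ContPSHOn (f i) Ω) :
    ContPSHOn (fun z => ∑ i ∈ s, f i z) Ω := by
  classical
  induction s using Finset.induction_on with
  | empty => simpa using const 0
  | insert i s hi ih =>
    simp only [Finset.sum_insert hi]
    exact (hf i (by simp)).add (ih fun j hj => hf j (by simp [hj]))

lemma translate (hu : ContPSHOn u Ω) (b : Cn n) (h : ∀ z ∈ Ω', z + b ∈ Ω) :
    ContPSHOn (fun z => u (z + b)) Ω' := by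
  refine ⟨hu.1.comp (by fun_prop) h, fun z w hd => ?_⟩
  have := hu.2 (z + b) w fun ζ hζ => by
    rw [add_right_comm]; exact h _ (hd ζ hζ)
  refine this.trans_eq ?_
  congr 1
  funext ζ
  rw [add_right_comm]

end ContPSHOn

lemma contPSHOn_re_inner (b : Cn n) (Ω : Set (Cn n)) :
    ContPSHOn (fun z => (inner ℂ b z).re) Ω := by
  refine ⟨by fun_prop, fun z w _ => ?_⟩
  have hF : Differentiable ℂ fun ζ : ℂ => inner ℂ b (z + ζ • w) := by
    simp only [inner_add_right, inner_smul_right]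
    fun_prop
  rw [circleAverage_re_of_differentiable hF]
  simp

/-- The difference |y - a|² - |y - z|² is real affine in y, hence pluriharmonic. It lies below |y -
a|², with equality at y = z. -/
lemma contPSHOn_norm_sub_sq (a : Cn n) (Ω : Set (Cn n)) :
    ContPSHOn (fun z => ‖z - a‖ ^ 2) Ω := by
  have hc : ContinuousOn (fun z : Cn n => ‖z - a‖ ^ 2) Ω := by fun_prop
  refine ⟨hc, fun z w hd => ?_⟩
  have h1 := ((contPSHOn_re_inner (z - a) Ω).const_mul (c := 2) (by norm_num)).add
    (ContPSHOn.const (-2 * (inner ℂ (z - a) a).re - ‖z - a‖ ^ 2))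
  have h2 := h1.2 z w hd
  have h3 : ∀ y : Cn n, ‖y - a - (z - a)‖ ^ 2 = ‖y - a‖ ^ 2 - (2 * (inner ℂ (z - a) y).re +
      (-2 * (inner ℂ (z - a) a).re - ‖z - a‖ ^ 2)) := by
    intro y
    rw [@norm_sub_sq ℂ, inner_re_symm, inner_sub_right (z - a) y a]
    simp only [map_sub, RCLike.re_to_complex]
    ring
  have h4 := h3 z
  simp only [sub_self, norm_zero] at h4
  have h5 : ‖z - a‖ ^ 2 = 2 * (inner ℂ (z - a) z).re +
      (-2 * (inner ℂ (z - a) a).re - ‖z - a‖ ^ 2) := by linarith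
  refine h5.le.trans (h2.trans (circleAverage_mono (circleIntegrable_disc h1.1 hd)
    (circleIntegrable_disc hc hd) fun ζ _ => ?_))
  have := h3 (z + ζ • w)
  have h6 := sq_nonneg ‖z + ζ • w - a - (z - a)‖
  linarith

/-! ### Gluing along the levels of a function -/

/-- Below the level the function is a maximum. At a point with d ≥ t it equals `u` and dominates `u`
nearby, so the sub-mean value property is inherited. The inequality on {d = t} gives this equality
on the level, and continuity. -/
lemma ContPSHOn.glue {D : Set (Cn n)} (hD : IsOpen D) {d : Cn n → ℝ} (hd : Continuous d)
    {u f : Cn n → ℝ} (hu : ContPSHOn u D) (hf : ContPSHOn f D) {t : ℝ}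
    (h : ∀ z ∈ D, d z = t → f z ≤ u z) :
    ContPSHOn (fun z => if d z ≤ t then Max.max (u z) (f z) else u z) D := by
  have hm := hu.max hf
  refine contPSHOn_of_locally ?_ fun z hz => ?_
  · refine ContinuousOn.if ?_ (hm.1.mono Set.inter_subset_left) (hu.1.mono Set.inter_subset_left)
    rintro z ⟨hz, hz'⟩
    exact max_eq_left (h z hz (frontier_le_subset_eq hd continuous_const hz'))
  · rcases lt_or_ge (d z) t with hlt | hge
    · refine ⟨D ∩ {y | d y < t}, fun y => Max.max (u y) (f y),
        hD.inter (isOpen_lt hd continuous_const), ⟨hz, hlt⟩, Set.inter_subset_left,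
        hm.mono Set.inter_subset_left, by simp [hlt.le], fun y hy => ?_⟩
      have : d y ≤ t := le_of_lt hy.2
      simp [this]
    · refine ⟨D, u, hD, hz, subset_rfl, hu, ?_, fun y _ => ?_⟩
      · split_ifs with h1
        · exact max_eq_left (h z hz (le_antisymm h1 hge))
        · rfl
      · split_ifs
        · exact le_max_left _ _
        · rfl

/-- The successive gluings of `q ^ k * u k` on the sublevel sets `{d ≤ t k}`. -/
def glueSeq (d : Cn n → ℝ) (t : ℕ → ℝ) (q : ℝ) (u : ℕ → Cn n → ℝ) : ℕ → Cn n → ℝ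
  | 0 => u 0
  | k + 1 => fun z => if d z ≤ t (k + 1) then
      max (glueSeq d t q u k z) (q ^ (k + 1) * u (k + 1) z) else glueSeq d t q u k z

lemma glueSeq_monotone (d : Cn n → ℝ) (t : ℕ → ℝ) (q : ℝ) (u : ℕ → Cn n → ℝ) (z : Cn n) :
    Monotone fun k => glueSeq d t q u k z := by
  refine monotone_nat_of_le_succ fun k => ?_
  simp only [glueSeq]
  split_ifs
  · exact le_max_left _ _
  · rfl

/-- Gluings after the k-th only change values on {d ≤ t (k + 1)}, so the sequence is locally
eventually constant and its limit remains psh. -/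
lemma glueSeq_eq_of_lt {d : Cn n → ℝ} {t : ℕ → ℝ} (ht : Antitone t) (q : ℝ) (u : ℕ → Cn n → ℝ)
    {z : Cn n} {k m : ℕ} (hk : t (k + 1) < d z) (hkm : k ≤ m) :
    glueSeq d t q u m z = glueSeq d t q u k z := by
  induction m, hkm using Nat.le_induction with
  | base => rfl
  | succ m hkm ih =>
    have : ¬ d z ≤ t (m + 1) := not_le.2 ((ht (by lia)).trans_lt hk)
    simp [glueSeq, this, ih]

/-- If on `D` there are negative plurisubharmonic functions that are `≤ -1` on `{t k ≤ d}` and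
`≥ -q` on `{d ≤ t (k + 1)}`, they can be glued to one that is `≥ -q ^ k` on `{d ≤ t k}`. -/
theorem exists_psh_of_levels {D : Set (Cn n)} (hD : IsOpen D) {d : Cn n → ℝ} (hd : Continuous d)
    (hdpos : ∀ z ∈ D, 0 < d z) {t : ℕ → ℝ} (ht : Antitone t)
    (ht0 : Filter.Tendsto t Filter.atTop (nhds 0)) {u : ℕ → Cn n → ℝ} {q : ℝ} (hq : 0 < q)
    (hu : ∀ k, ContPSHOn (u k) D) (hneg : ∀ k, ∀ z ∈ D, u k z < 0)
    (hup : ∀ k, ∀ z ∈ D, t k ≤ d z → u k z ≤ -1)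
    (hlow : ∀ k, ∀ z ∈ D, d z ≤ t (k + 1) → -q ≤ u k z) :
    ∃ ρ : Cn n → ℝ, ContPSHOn ρ D ∧ (∀ z ∈ D, ρ z < 0) ∧
      ∀ k, ∀ z ∈ D, d z ≤ t (k + 1) → -q ^ (k + 1) ≤ ρ z := by
  set P := glueSeq d t q u with hP
  have hPs : ∀ k z, P (k + 1) z = if d z ≤ t (k + 1) then
      max (P k z) (q ^ (k + 1) * u (k + 1) z) else P k z := fun k z => rfl
  have inv : ∀ k, ContPSHOn (P k) D ∧ (∀ z ∈ D, P k z < 0) ∧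
      ∀ z ∈ D, d z ≤ t (k + 1) → -q ^ (k + 1) ≤ P k z := by
    intro k
    induction k with
    | zero =>
      refine ⟨hu 0, hneg 0, fun z hz h => ?_⟩
      simpa [hP, glueSeq] using hlow 0 z hz h
    | succ k ih =>
      obtain ⟨h1, h2, h3⟩ := ih
      have hqk : 0 < q ^ (k + 1) := by positivity
      refine ⟨h1.glue hD hd ((hu (k + 1)).const_mul hqk.le) fun z hz h => ?_, fun z hz => ?_,
        fun z hz h => ?_⟩
      -- On {d = t (k + 1)} the new function is ≤ -q ^ (k + 1), which the invariant places below `P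
      -- k`.
      · have := mul_le_mul_of_nonneg_left (hup (k + 1) z hz h.ge) hqk.le
        linarith [h3 z hz h.le]
      · rw [hPs]
        split_ifs
        · exact max_lt (h2 z hz) (mul_neg_of_pos_of_neg hqk (hneg _ z hz))
        · exact h2 z hz
      · rw [hPs, if_pos (h.trans (ht (by lia)))]
        refine le_trans ?_ (le_max_right _ _)
        have := mul_le_mul_of_nonneg_left (hlow (k + 1) z hz h) hqk.le
        rw [pow_succ]
        linarith
  have hK : ∀ z, ∃ k, z ∈ D → t (k + 1) < d z := by
    intro z
    by_cases hz : z ∈ D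
    · have := ((Filter.tendsto_add_atTop_iff_nat 1).2 ht0).eventually_lt_const (hdpos z hz)
      obtain ⟨k, hk⟩ := this.exists
      exact ⟨k, fun _ => hk⟩
    · exact ⟨0, fun h => absurd h hz⟩
  choose K hK using hK
  refine ⟨fun z => P (K z) z, contPSHOn_of_locally_eq fun z hz => ?_,
    fun z hz => (inv _).2.1 z hz, fun k z hz h => ?_⟩
  · refine ⟨D ∩ {y | t (K z + 1) < d y}, P (K z), hD.inter (isOpen_lt continuous_const hd),
      ⟨hz, hK z hz⟩, Set.inter_subset_left, (inv _).1.mono Set.inter_subset_left, fun y hy => ?_⟩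
    rcases le_total (K y) (K z) with h | h
    · exact (glueSeq_eq_of_lt ht q u (hK y hy.1) h).symm
    · exact glueSeq_eq_of_lt ht q u hy.2 h
  · have hlt : k ≤ K z := by
      by_contra hcon
      have := ht (show K z + 1 ≤ k + 1 by lia)
      linarith [hK z hz]
    exact ((inv k).2.2 z hz h).trans (glueSeq_monotone d t q u z hlt)

/-! ### The boundary distance -/

lemma continuous_bdryDist (Ω : Set (Cn n)) : Continuous (bdryDist Ω) :=
  continuous_infDist_pt _

lemma bdryDist_pos {Ω : Set (Cn n)} (hΩ : IsOpen Ω) (hne : (frontier Ω).Nonempty) {z : Cn n}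
    (hz : z ∈ Ω) : 0 < bdryDist Ω z := by
  refine (isClosed_frontier.notMem_iff_infDist_pos hne).1 fun h => ?_
  rw [hΩ.frontier_eq] at h
  exact h.2 hz

lemma bdryDist_add_le (Ω : Set (Cn n)) (z y : Cn n) : bdryDist Ω (z + y) ≤ bdryDist Ω z + ‖y‖ := by
  have := infDist_le_infDist_add_dist (s := frontier Ω) (x := z + y) (y := z)
  simpa [bdryDist, dist_eq_norm] using this

lemma bdryDist_le_add (Ω : Set (Cn n)) (z y : Cn n) : bdryDist Ω z ≤ bdryDist Ω (z + y) + ‖y‖ := by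
  have := infDist_le_infDist_add_dist (s := frontier Ω) (x := z) (y := z + y)
  simpa [bdryDist, dist_eq_norm] using this

/-! ### Heights and horizontal projections -/

lemma height_add (v x y : Cn n) : height v (x + y) = height v x + height v y := by
  simp [height]

lemma height_sub (v x y : Cn n) : height v (x - y) = height v x - height v y := by
  simp [height]

lemma height_smul_self {v : Cn n} (hv : ‖v‖ = 1) (s : ℝ) : height v ((s : ℂ) • v) = s := by
  simp [height, hv]

lemma abs_height_le {v : Cn n} (hv : ‖v‖ = 1) (x : Cn n) : |height v x| ≤ ‖x‖ := by
  have := (Complex.abs_re_le_norm (inner ℂ v x)).trans (norm_inner_le_norm v x)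
  simpa [height, hv] using this

lemma height_horiz {v : Cn n} (hv : ‖v‖ = 1) (x : Cn n) : height v (horiz v x) = 0 := by
  rw [horiz, height_sub, height_smul_self hv, sub_self]

lemma horiz_sub (v x y : Cn n) : horiz v (x - y) = horiz v x - horiz v y := by
  simp only [horiz, height_sub, Complex.ofReal_sub]
  module

lemma horiz_add_smul {v : Cn n} (hv : ‖v‖ = 1) (x : Cn n) (s : ℝ) :
    horiz v (x + (s : ℂ) • v) = horiz v x := by
  simp only [horiz, height_add, height_smul_self hv, Complex.ofReal_add]
  module

lemma norm_horiz_le {v : Cn n} (hv : ‖v‖ = 1) (x : Cn n) : ‖horiz v x‖ ≤ ‖x‖ := by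
  have h : ‖horiz v x‖ ^ 2 = ‖x‖ ^ 2 - height v x ^ 2 := by
    rw [horiz, @norm_sub_sq ℂ, norm_smul, hv, inner_smul_right, 
      Complex.norm_real, mul_one, norm_eq_abs, sq_abs]
    have : (inner ℂ x v).re = height v x := by
      rw [height, ← RCLike.re_to_complex, inner_re_symm]; rfl
    simp only [RCLike.re_to_complex, Complex.re_ofReal_mul, this]
    ring
  nlinarith [norm_nonneg x, norm_nonneg (horiz v x), sq_nonneg (height v x)]

lemma continuous_height (v : Cn n) : Continuous (height v) := by
  unfold height; fun_prop

lemma continuous_horiz (v : Cn n) : Continuous (horiz v) := by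
  have := continuous_height v
  unfold horiz; fun_prop

/-! ### Pushing a domain with Hölder boundary into itself -/

/-- Near a boundary point of Hölder order `β`, one may move away from the boundary, in a locally
constant direction, such that the boundary distance after a step of length `t` is at least
a constant times `t ^ (1 / β)`. -/
lemma exists_inward_direction {Ω : Set (Cn n)} (hΩ : IsOpen Ω) {a : Cn n} (ha : a ∈ frontier Ω)
    {β : ℝ≥0} (hβ : 0 < β) (hβ1 : β ≤ 1) (hg : IsHolderGraphAt Ω a β) :
    ∃ R > 0, ∃ A : ℝ, 0 ≤ A ∧ ∃ T > 0, ∃ e : Cn n → Cn n, (∀ z, ‖e z‖ = 1) ∧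
      (∀ z ∈ Ω ∩ ball a R, ∃ N, IsOpen N ∧ z ∈ N ∧ N ⊆ Ω ∩ ball a R ∧ ∀ y ∈ N, e y = e z) ∧
      ∀ z ∈ Ω ∩ ball a R, ∀ t : ℝ, 0 < t → t < T → z + (t : ℂ) • e z ∈ Ω ∧
        β * -log (bdryDist Ω (z + (t : ℂ) • e z)) ≤ -log t + A := by
  obtain ⟨v, r, C, g, hv, hr, hgH, hgr⟩ := hg
  have hβ' : (0 : ℝ) < β := hβ
  have hβ1' : (β : ℝ) ≤ 1 := hβ1
  have hmaps : ∀ z ∈ ball a r, horiz v (z - a) ∈ {x | x ∈ ball (0 : Cn n) r ∧ height v x = 0} := by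
    intro z hz
    refine ⟨?_, height_horiz hv _⟩
    rw [mem_ball_zero_iff]
    exact (norm_horiz_le hv _).trans_lt (mem_ball_iff_norm.1 hz)
  let F : Cn n → ℝ := fun z => height v (z - a) - g (horiz v (z - a))
  have hFc : ContinuousOn F (ball a r) := by
    refine ContinuousOn.sub ((continuous_height v).comp (by fun_prop)).continuousOn ?_
    exact (hgH.continuousOn hβ).comp ((continuous_horiz v).comp (by fun_prop)).continuousOn hmaps
  have hF0 : ∀ z ∈ ball a r, (z ∈ frontier Ω ↔ F z = 0) := by
    intro z hz
    rw [hgr z hz]; exact sub_eq_zero.symm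
  have hFs : ∀ z (s : ℝ), F (z + (s : ℂ) • v) = F z + s := by
    intro z s
    simp only [F, add_sub_right_comm, height_add, horiz_add_smul hv, height_smul_self hv]
  have hRsub : Ω ∩ ball a (r / 4) ⊆ ball a r :=
    Set.inter_subset_right.trans (ball_subset_ball (by linarith))
  have hFne : ∀ z ∈ Ω ∩ ball a (r / 4), F z ≠ 0 := by
    intro z hz h
    have := (hF0 z (hRsub hz)).2 h
    rw [hΩ.frontier_eq] at this
    exact this.2 hz.1
  have hD : IsOpen (Ω ∩ ball a (r / 4)) := hΩ.inter isOpen_ball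
  -- Ω may lie on either or both sides of the graph. Since `F` does not vanish on Ω near a, its sign
  -- is locally constant there, and moving along σ v increases |F| at unit rate.
  let σ : Cn n → ℝ := fun z => if 0 < F z then 1 else -1
  have hσ1 : ∀ z, |σ z| = 1 := by
    intro z; simp only [σ]; split_ifs <;> simp
  have hσF : ∀ z ∈ Ω ∩ ball a (r / 4), ∀ s : ℝ, 0 ≤ s → s < |F z + s * σ z| := by
    intro z hz s hs
    simp only [σ]
    split_ifs with h
    · rw [mul_one, abs_of_pos (by linarith)]; linarith
    · have h' : F z < 0 := lt_of_le_of_ne (not_lt.1 h) (hFne z hz)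
      rw [abs_of_neg (by linarith)]; linarith
  have hen : ∀ z (s : ℝ), ‖((s * σ z : ℝ) : ℂ) • v‖ = |s| := by
    intro z s
    rw [norm_smul, hv, mul_one, Complex.norm_real, norm_eq_abs, abs_mul, hσ1, mul_one]
  have hball : ∀ z ∈ Ω ∩ ball a (r / 4), ∀ s : ℝ, 0 ≤ s → s ≤ r / 4 →
      z + ((s * σ z : ℝ) : ℂ) • v ∈ ball a (r / 2) := by
    intro z hz s hs hs'
    rw [mem_ball_iff_norm, add_sub_right_comm]
    have h1 := mem_ball_iff_norm.1 hz.2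
    have h2 := norm_add_le (z - a) (((s * σ z : ℝ) : ℂ) • v)
    rw [hen, abs_of_nonneg hs] at h2
    linarith
  have hne : (frontier Ω).Nonempty := ⟨a, ha⟩
  -- The three bounds on t keep the shifted point in B(a, r/2), and give t ≤ δ ^ β directly when the
  -- nearest boundary point is at distance more than 1 or lies outside B(a, r).
  refine ⟨r / 4, by positivity, log (C + 1), log_nonneg (by simp),
    min (min (r / 4) 1) ((r / 4) ^ (β : ℝ)), by positivity, fun z => ((σ z : ℝ) : ℂ) • v,
    fun z => by simpa using hen z 1, fun z hz => ?_, fun z hz t ht htT => ?_⟩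
  · rcases lt_or_gt_of_ne (hFne z hz) with h | h
    · refine ⟨Ω ∩ ball a (r / 4) ∩ F ⁻¹' Set.Iio 0,
        (hFc.mono hRsub).isOpen_inter_preimage hD isOpen_Iio,
        ⟨hz, h⟩, Set.inter_subset_left, fun y hy => ?_⟩
      have hy' : F y < 0 := hy.2
      simp [σ, not_lt.2 hy'.le, not_lt.2 h.le]
    · refine ⟨Ω ∩ ball a (r / 4) ∩ F ⁻¹' Set.Ioi 0,
        (hFc.mono hRsub).isOpen_inter_preimage hD isOpen_Ioi,
        ⟨hz, h⟩, Set.inter_subset_left, fun y hy => ?_⟩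
      have hy' : 0 < F y := hy.2
      simp [σ, hy', h]
  · have htr : t < r / 4 := htT.trans_le ((min_le_left _ _).trans (min_le_left _ _))
    have ht1 : t < 1 := htT.trans_le ((min_le_left _ _).trans (min_le_right _ _))
    have htβ : t < (r / 4) ^ (β : ℝ) := htT.trans_le (min_le_right _ _)
    have hsm : (t : ℂ) • ((σ z : ℝ) : ℂ) • v = ((t * σ z : ℝ) : ℂ) • v := by
      rw [smul_smul]; simp
    rw [hsm]
    -- The segment starts in Ω and cannot leave it: a frontier point on it would be a zero of `F`,
    -- while |F| exceeds the distance travelled.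
    have hmem : z + ((t * σ z : ℝ) : ℂ) • v ∈ Ω := by
      have hpre : IsPreconnected ((fun s : ℝ => z + ((s * σ z : ℝ) : ℂ) • v) '' Set.Icc 0 t) :=
        isPreconnected_Icc.image _ (by fun_prop)
      have := hpre.subset_of_closure_inter_subset hΩ ?_ ?_
      · exact this ⟨t, ⟨ht.le, le_rfl⟩, rfl⟩
      · exact ⟨z, ⟨0, ⟨le_rfl, ht.le⟩, by simp⟩, hz.1⟩
      · rintro _ ⟨hcl, s, hs, rfl⟩
        by_contra hcon
        have hb := ball_subset_ball (by linarith : r / 2 ≤ r) (hball z hz s hs.1 (by linarith [hs.2]))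
        have h0 := (hF0 _ hb).1 (by rw [hΩ.frontier_eq]; exact ⟨hcl, hcon⟩)
        rw [hFs] at h0
        have := hσF z hz s hs.1
        rw [h0, abs_zero] at this
        linarith [hs.1]
    refine ⟨hmem, ?_⟩
    set y := z + ((t * σ z : ℝ) : ℂ) • v with hy
    have hyb : y ∈ ball a (r / 2) := hball z hz t ht.le htr.le
    have hyb' : y ∈ ball a r := ball_subset_ball (by linarith) hyb
    have hdpos := bdryDist_pos hΩ hne hmem
    -- If the nearest frontier point p lies in B(a, r), then F p = 0, so t ≤ |F y - F p| ≤ |y - p| +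
    -- C |y - p| ^ β.
    have key : t ≤ (C + 1) * bdryDist Ω y ^ (β : ℝ) := by
      obtain ⟨p, hp, hpd⟩ := isClosed_frontier.exists_infDist_eq_dist hne y
      have hpd' : bdryDist Ω y = dist y p := hpd
      rw [hpd'] at hdpos ⊢
      have hC : (0 : ℝ) ≤ C := C.2
      have hpw : 0 < dist y p ^ (β : ℝ) := by positivity
      by_cases hpb : p ∈ ball a r
      · rcases le_or_gt (dist y p) 1 with h1 | h1
        · have hFp := (hF0 p hpb).1 hp
          have hFy : t ≤ |F y| := by rw [hy, hFs]; exact (hσF z hz t ht.le).le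
          have e1 : F y = height v (y - p) -
              (g (horiz v (y - a)) - g (horiz v (p - a))) := by
            have : height v (y - p) = height v (y - a) - height v (p - a) := by
              rw [← height_sub]; congr 1; abel
            rw [this]
            simp only [F] at hFp ⊢
            linarith
          have e2 := hgH.dist_le (hmaps y hyb') (hmaps p hpb)
          rw [Real.dist_eq, dist_eq_norm, ← horiz_sub, sub_sub_sub_cancel_right] at e2
          have e3 : ‖horiz v (y - p)‖ ^ (β : ℝ) ≤ dist y p ^ (β : ℝ) := by
            rw [dist_eq_norm]
            exact rpow_le_rpow (norm_nonneg _) (norm_horiz_le hv _) hβ'.le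
          have e4 := abs_height_le hv (y - p)
          rw [← dist_eq_norm] at e4
          have e5 : dist y p ≤ dist y p ^ (β : ℝ) := by
            simpa using rpow_le_rpow_of_exponent_ge hdpos h1 hβ1'
          have e6 := abs_sub (height v (y - p)) (g (horiz v (y - a)) - g (horiz v (p - a)))
          rw [← e1] at e6
          have e7 := mul_le_mul_of_nonneg_left e3 hC
          linarith
        · have := one_le_rpow h1.le hβ'.le
          nlinarith
      · have h1 : r / 4 ≤ dist y p := by
          have := dist_triangle p y a
          rw [mem_ball] at hpb hyb
          rw [dist_comm p y] at this
          linarith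
        have h2 := rpow_le_rpow (by positivity) h1 hβ'.le
        nlinarith
    have h1 := log_le_log ht key
    rw [log_mul (by positivity) (by positivity), log_rpow hdpos] at h1
    linarith

/-! ### The local construction -/

/-- Both sides agree at Λ = 1, and the derivative of the right-hand side there is β - τ (1 - β) > 0.
-/
lemma exists_ratio {β τ : ℝ} (h : τ * (1 - β) < β) :
    ∃ Λ > 1, 1 - β < Λ ^ (-τ) * (1 - β / Λ) := by
  have hd : HasDerivAt (fun x : ℝ => x ^ (-τ) * (1 - β / x)) (β - τ * (1 - β)) 1 := by
    have h1 : HasDerivAt (fun x : ℝ => x ^ (-τ)) (-τ * 1 ^ (-τ - 1)) 1 :=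
      hasDerivAt_rpow_const (Or.inl one_ne_zero)
    have h2 : HasDerivAt (fun x : ℝ => 1 - β * x⁻¹) (-(β * -(1 ^ 2)⁻¹)) 1 :=
      ((hasDerivAt_inv one_ne_zero).const_mul β).const_sub 1
    simp only [div_eq_mul_inv]
    refine (h1.mul h2).congr_deriv ?_
    simp only [one_rpow]
    ring
  have hs := (hasDerivAt_iff_tendsto_slope.1 hd).eventually_const_lt (sub_pos.2 h)
  have hs' := hs.filter_mono (nhdsWithin_mono (1 : ℝ) (fun x (hx : x ∈ Set.Ioi (1 : ℝ)) => ne_of_gt hx))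
  obtain ⟨Λ, hΛ, hΛ1⟩ := (hs'.and self_mem_nhdsWithin).exists
  refine ⟨Λ, hΛ1, ?_⟩
  rw [slope_def_field, lt_div_iff₀ (sub_pos.2 hΛ1)] at hΛ
  simp only [one_rpow, div_one] at hΛ
  linarith

/-- Near a boundary point of Hölder order `β` there are negative plurisubharmonic functions that
tend to zero at the boundary like `(-log δ) ^ (-τ)`, for every `τ < β / (1 - β)`. -/
theorem exists_local_psh {Ω : Set (Cn n)} (hΩ : IsOpen Ω) (hpsc : IsPseudoconvex Ω) {a : Cn n}
    (ha : a ∈ frontier Ω) {β : ℝ≥0} (hβ : 0 < β) (hβ1 : β ≤ 1) (hg : IsHolderGraphAt Ω a β) :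
    ∃ R > 0, ∀ τ : ℝ, 0 < τ → τ * (1 - (β : ℝ)) < β → ∃ φ : Cn n → ℝ,
      ContPSHOn φ (Ω ∩ ball a R) ∧ (∀ z ∈ Ω ∩ ball a R, φ z < 0) ∧
      ∃ C ε : ℝ, 0 < C ∧ 0 < ε ∧ ε < 1 ∧ ∀ z ∈ Ω ∩ ball a R, bdryDist Ω z < ε →
        -φ z ≤ C * (-log (bdryDist Ω z)) ^ (-τ) := by
  obtain ⟨R, hR, A, hA, T, hT, e, he1, hloc, hshift⟩ := exists_inward_direction hΩ ha hβ hβ1 hg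
  refine ⟨R, hR, fun τ hτ hτβ => ?_⟩
  have hβ' : (0 : ℝ) < β := hβ
  have hβ1' : (β : ℝ) ≤ 1 := hβ1
  have hne : (frontier Ω).Nonempty := ⟨a, ha⟩
  have hD : IsOpen (Ω ∩ ball a R) := hΩ.inter isOpen_ball
  obtain ⟨Λ, hΛ, hΛq⟩ := exists_ratio hτβ
  have hΛ0 : 0 < Λ := by linarith
  set q : ℝ := Λ ^ (-τ) with hq
  have hq0 : 0 < q := by positivity
  set κ : ℝ := q * Λ - q * β - (1 - β) * Λ with hκ
  have hκ0 : 0 < κ := by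
    have : κ = Λ * (q * (1 - β / Λ) - (1 - β)) := by rw [hκ]; field_simp
    rw [this]
    exact mul_pos hΛ0 (by linarith)
  set B : ℝ := (A + 1) * (1 - q) + β * (1 + q) * log 2 with hB
  -- A large starting scale absorbs the additive constants collected in `B`, puts every step below
  -- `T`, and makes t_{k+1} ≤ t_k / 2.
  set l : ℝ := max (max 1 (B / κ)) (max (1 - log T) (log 2 / (Λ - 1))) with hl
  have hl1 : 1 ≤ l := (le_max_left _ _).trans (le_max_left _ _)
  have hlB : B / κ ≤ l := (le_max_right _ _).trans (le_max_left _ _)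
  have hlT : 1 - log T ≤ l := (le_max_left _ _).trans (le_max_right _ _)
  have hl2 : log 2 / (Λ - 1) ≤ l := (le_max_right _ _).trans (le_max_right _ _)
  have hlog2 : 0 < log 2 := log_pos (by norm_num)
  let L : ℕ → ℝ := fun k => l * Λ ^ k
  have hLs : ∀ k, L (k + 1) = Λ * L k := fun k => by simp only [L]; ring
  have hLl : ∀ k, l ≤ L k := fun k => le_mul_of_one_le_right (by linarith) (one_le_pow₀ hΛ.le)
  have hLmono : Monotone L := monotone_nat_of_le_succ fun k => by
    rw [hLs]; nlinarith [hLl k]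
  have hLtop : Filter.Tendsto L Filter.atTop Filter.atTop :=
    (tendsto_pow_atTop_atTop_of_one_lt hΛ).const_mul_atTop (by linarith)
  have htT : ∀ k, exp (-L k) < T := fun k => by
    rw [← exp_log hT]; exact exp_lt_exp.2 (by linarith [hLl k])
  have hhalf : ∀ k, 2 * exp (-L (k + 1)) ≤ exp (-L k) := fun k => by
    have h1 : log 2 ≤ L k * (Λ - 1) :=
      (div_le_iff₀ (by linarith)).1 (hl2.trans (hLl k))
    calc 2 * exp (-L (k + 1)) = exp (log 2 + -L (k + 1)) := by
          rw [exp_add, exp_log (by norm_num)]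
      _ ≤ exp (-L k) := exp_le_exp.2 (by rw [hLs]; linarith)
  have hBk : ∀ k, B ≤ L k * κ := fun k =>
    (div_le_iff₀ hκ0).1 (hlB.trans (hLl k))
  let ψ : ℕ → Cn n → ℝ := fun k z => -log (bdryDist Ω (z + (exp (-L (k + 1)) : ℂ) • e z))
  have hψ : ∀ k, ContPSHOn (ψ k) (Ω ∩ ball a R) := fun k => by
    refine contPSHOn_of_locally_eq fun z hz => ?_
    obtain ⟨N, hN, hzN, hND, hNe⟩ := hloc z hz
    refine ⟨N, fun y => -log (bdryDist Ω (y + (exp (-L (k + 1)) : ℂ) • e z)), hN, hzN, hND,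
      hpsc.translate _ fun y hy => ?_, fun y hy => by simp only [ψ, hNe y hy]⟩
    rw [← hNe y hy]
    exact (hshift y (hND hy) _ (exp_pos _) (htT (k + 1))).1
  have hψpos : ∀ k, ∀ z ∈ Ω ∩ ball a R,
      0 < bdryDist Ω (z + (exp (-L (k + 1)) : ℂ) • e z) := fun k z hz =>
    bdryDist_pos hΩ hne (hshift z hz _ (exp_pos _) (htT (k + 1))).1
  have hψle : ∀ k, ∀ z ∈ Ω ∩ ball a R, β * ψ k z ≤ L (k + 1) + A := fun k z hz => by
    have := (hshift z hz _ (exp_pos _) (htT (k + 1))).2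
    rw [log_exp, neg_neg] at this
    exact this
  have hnorm : ∀ k z, ‖(exp (-L (k + 1)) : ℂ) • e z‖ = exp (-L (k + 1)) := fun k z => by
    rw [norm_smul, he1, mul_one, Complex.norm_real, norm_of_nonneg (exp_pos _).le]
  -- `M k` is the gap between L (k + 1) + A + 1, which exceeds β ψ by at least 1, and the bound for
  -- β ψ on {δ ≥ t_k}; dividing by it normalizes that region to ≤ -1. The left side of `hqM` is the
  -- corresponding gap on {δ ≤ t_{k+1}}, and `hqM` is equivalent to B ≤ κ L k.
  let M : ℕ → ℝ := fun k => L (k + 1) + (A + 1) - β * (L k + log 2)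
  have hqM : ∀ k, (1 - β) * (L (k + 1) + (A + 1)) + β * (A + 1 + log 2) ≤ q * M k := fun k => by
    have := hBk k
    simp only [M, hLs]
    rw [hB, hκ] at this
    linarith
  have hM : ∀ k, 0 < M k := fun k => by
    refine pos_of_mul_pos_right (lt_of_lt_of_le ?_ (hqM k)) hq0.le
    have : 0 ≤ (1 - (β : ℝ)) * (L (k + 1) + (A + 1)) :=
      mul_nonneg (by linarith) (by linarith [hLl (k + 1)])
    positivity
  obtain ⟨ρ, hρ, hρ0, hρlow⟩ := exists_psh_of_levels (d := bdryDist Ω) (t := fun k => exp (-L k))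
    (u := fun k z => (M k)⁻¹ * (β * ψ k z + -(L (k + 1) + (A + 1)))) hD
    (continuous_bdryDist Ω) (fun z hz => bdryDist_pos hΩ hne hz.1)
    (fun i j hij => exp_le_exp.2 (neg_le_neg (hLmono hij)))
    (tendsto_exp_neg_atTop_nhds_zero.comp hLtop) hq0
    (fun k => (((hψ k).const_mul hβ'.le).add (ContPSHOn.const _)).const_mul (inv_pos.2 (hM k)).le)
    (fun k z hz => mul_neg_of_pos_of_neg (inv_pos.2 (hM k)) (by linarith [hψle k z hz]))
    (fun k z hz hk => by
      rw [inv_mul_le_iff₀ (hM k)]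
      have h1 := bdryDist_le_add Ω z ((exp (-L (k + 1)) : ℂ) • e z)
      rw [hnorm] at h1
      have h2 : exp (-L k + -log 2) ≤ bdryDist Ω (z + (exp (-L (k + 1)) : ℂ) • e z) := by
        rw [exp_add, exp_neg (log 2), exp_log (by norm_num)]
        linarith [hhalf k]
      have h3 := (le_log_iff_exp_le (hψpos k z hz)).2 h2
      have h4 : ψ k z ≤ L k + log 2 := by simp only [ψ]; linarith
      have := mul_le_mul_of_nonneg_left h4 hβ'.le
      simp only [M]
      linarith)
    (fun k z hz hk => by
      rw [le_inv_mul_iff₀ (hM k)]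
      have h1 := bdryDist_add_le Ω z ((exp (-L (k + 1)) : ℂ) • e z)
      rw [hnorm] at h1
      have h2 : bdryDist Ω (z + (exp (-L (k + 1)) : ℂ) • e z) ≤ exp (-L (k + 1) + log 2) := by
        rw [exp_add, exp_log (by norm_num)]
        linarith
      have h3 := (log_le_iff_le_exp (hψpos k z hz)).2 h2
      have h4 : L (k + 1) - log 2 ≤ ψ k z := by simp only [ψ]; linarith
      have := mul_le_mul_of_nonneg_left h4 hβ'.le
      have := hqM k
      linarith)
  have hl0 : 0 < l * Λ := by positivity
  refine ⟨ρ, hρ, hρ0, (l * Λ) ^ τ, exp (-(l * Λ)), by positivity, exp_pos _,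
    exp_lt_one_iff.2 (by linarith), fun z hz hzε => ?_⟩
  have hdz := bdryDist_pos hΩ hne hz.1
  set x := -log (bdryDist Ω z) with hx
  have hxl : l * Λ < x := by
    have := (log_lt_iff_lt_exp hdz).2 hzε
    linarith
  have hxl' : Λ < x / l := (lt_div_iff₀ (by linarith)).2 (by linarith)
  obtain ⟨k, hk, hk'⟩ := exists_nat_pow_near (x := x / l) (y := Λ) (by linarith) hΛ
  -- The level estimates start at index 1; this is why ε is exp (-(l * Λ)) and not exp (-l).
  have hk0 : k ≠ 0 := by
    rintro rfl
    simp only [zero_add, pow_one] at hk'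
    linarith
  obtain ⟨j, rfl⟩ := Nat.exists_eq_succ_of_ne_zero hk0
  have h1 := hρlow j z hz (by
    rw [← log_le_iff_le_exp hdz]
    rw [le_div_iff₀ (by linarith)] at hk
    simp only [L, Nat.succ_eq_add_one] at hk ⊢
    linarith)
  have h2 : x / (l * Λ) ≤ Λ ^ (j + 1) := by
    rw [div_le_iff₀ hl0]
    rw [div_lt_iff₀ (by linarith)] at hk'
    simp only [Nat.succ_eq_add_one, pow_succ] at hk' ⊢
    linarith
  have hx0 : 0 < x := hl0.trans hxl
  have h3 : q ^ (j + 1) = (Λ ^ (j + 1)) ^ (-τ) := by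
    rw [hq, ← rpow_natCast, ← rpow_natCast, ← rpow_mul hΛ0.le, ← rpow_mul hΛ0.le, mul_comm]
  calc -ρ z ≤ q ^ (j + 1) := by linarith
    _ = (Λ ^ (j + 1)) ^ (-τ) := h3
    _ ≤ (x / (l * Λ)) ^ (-τ) := rpow_le_rpow_of_nonpos (by positivity) h2 (by linarith)
    _ = (l * Λ) ^ τ * x ^ (-τ) := by
      rw [div_rpow hx0.le hl0.le, rpow_neg hl0.le, div_inv_eq_mul, mul_comm]

/-- A logarithm grows more slowly than any power. This converts the linear decay of the barrier at
the sphere to the logarithmic rate. -/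
lemma mul_le_const_mul_neg_log_rpow {τ : ℝ} (hτ : 0 < τ) {x : ℝ} (hx : 0 < x) (hx1 : x < 1) :
    x ≤ τ ^ τ * (-log x) ^ (-τ) := by
  have hl : 0 < -log x := neg_pos.2 (log_neg hx hx1)
  have h1 : -log x ≤ τ * x ^ (-τ⁻¹) := by
    have := log_le_rpow_div (x := x⁻¹) (by positivity) (inv_pos.2 hτ)
    rw [log_inv, inv_rpow hx.le, ← rpow_neg hx.le, div_inv_eq_mul] at this
    linarith
  have h2 := rpow_le_rpow_of_nonpos hl h1 (neg_nonpos.2 hτ.le)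
  rw [mul_rpow hτ.le (by positivity), ← rpow_mul hx.le, neg_mul_neg, inv_mul_cancel₀ hτ.ne',
    rpow_one, rpow_neg hτ.le, inv_mul_le_iff₀ (by positivity)] at h2
  exact h2

/-- The quantitative local statement for the intersections of `Ω` with small balls. -/
theorem exists_psh_inter_ball {Ω : Set (Cn n)} (hΩ : IsOpen Ω) (hpsc : IsPseudoconvex Ω)
    {a : Cn n} (ha : a ∈ frontier Ω) {β : ℝ≥0} (hβ : 0 < β) (hβ1 : β ≤ 1)
    (hg : IsHolderGraphAt Ω a β) :
    ∃ R : ℝ, 0 < R ∧ ∀ r : ℝ, 0 < r → r < R → ∀ τ : ℝ, τ * (1 - (β : ℝ)) < (β : ℝ) →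
      ∃ ρ : Cn n → ℝ, ContPSHOn ρ (Ω ∩ ball a r) ∧ (∀ z ∈ Ω ∩ ball a r, ρ z < 0) ∧
        ∃ C ε : ℝ, 0 < C ∧ 0 < ε ∧ ε < 1 ∧ ∀ z ∈ Ω ∩ ball a r, bdryDist (Ω ∩ ball a r) z < ε →
          -ρ z ≤ C * (-log (bdryDist (Ω ∩ ball a r) z)) ^ (-τ) := by
  obtain ⟨R, hR, hloc⟩ := exists_local_psh hΩ hpsc ha hβ hβ1 hg
  refine ⟨R, hR, fun r hr hrR τ hτβ => ?_⟩
  have hβ' : (0 : ℝ) < β := hβ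
  have hβ1' : (β : ℝ) ≤ 1 := hβ1
  -- For τ ≤ 0 the positive exponent β, always admissible, gives a stronger estimate once -log δ ≥
  -- 1; hence exp (-1) in the choice of ε.
  obtain ⟨σ, hσ, hτσ, hσβ⟩ : ∃ σ : ℝ, 0 < σ ∧ τ ≤ σ ∧ σ * (1 - (β : ℝ)) < β := by
    rcases lt_or_ge 0 τ with h | h
    · exact ⟨τ, h, le_rfl, hτβ⟩
    · exact ⟨β, hβ', h.trans hβ'.le, by nlinarith⟩
  obtain ⟨φ, hφ, hφ0, C, ε, hC, hε, hε1, hest⟩ := hloc σ hσ hσβ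
  have hsub : Ω ∩ ball a r ⊆ Ω ∩ ball a R :=
    Set.inter_subset_inter_right _ (ball_subset_ball hrR.le)
  have hne : (frontier Ω).Nonempty := ⟨a, ha⟩
  have hDo : IsOpen (Ω ∩ ball a r) := hΩ.inter isOpen_ball
  refine ⟨fun z => max (φ z) (‖z - a‖ ^ 2 + -r ^ 2), (hφ.mono hsub).max
    ((contPSHOn_norm_sub_sq a _).add (ContPSHOn.const _)), fun z hz => ?_,
    C + 2 * r * σ ^ σ, min ε (exp (-1)), by positivity, by positivity,
    (min_le_left _ _).trans_lt hε1, fun z hz hzε => ?_⟩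
  · refine max_lt (hφ0 z (hsub hz)) ?_
    have := mem_ball_iff_norm.1 hz.2
    nlinarith [norm_nonneg (z - a)]
  · have hDne : (frontier (Ω ∩ ball a r)).Nonempty := by
      refine nonempty_frontier_iff.2 ⟨⟨z, hz⟩, fun h => ?_⟩
      have h1 : a ∈ Ω ∩ ball a r := h ▸ Set.mem_univ a
      rw [hΩ.frontier_eq] at ha
      exact ha.2 h1.1
    have hd0 := bdryDist_pos hDo hDne hz
    set x := bdryDist (Ω ∩ ball a r) z with hx
    have hxε : x < ε := hzε.trans_le (min_le_left _ _)
    have hxe : 1 ≤ -log x := by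
      have := (log_lt_iff_lt_exp hd0).2 (hzε.trans_le (min_le_right _ _))
      linarith
    have hx1 : x < 1 := hxε.trans hε1
    have hpow : (-log x) ^ (-σ) ≤ (-log x) ^ (-τ) :=
      rpow_le_rpow_of_exponent_le hxe (by linarith)
    have hpos : 0 < (-log x) ^ (-σ) := by positivity
    have hK : 0 < C + 2 * r * σ ^ σ := by positivity
    refine le_trans ?_ (mul_le_mul_of_nonneg_left hpow hK.le)
    have hsum : 0 ≤ 2 * r * σ ^ σ := by positivity
    obtain ⟨p, hp, hpd⟩ := isClosed_frontier.exists_infDist_eq_dist hDne z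
    have hpd' : x = dist z p := hpd
    -- The nearest point of ∂D lies on ∂Ω, where φ controls the maximum, or on the sphere, where the
    -- quadratic barrier does.
    rcases frontier_inter_subset _ _ hp with hp' | hp'
    · have h1 : bdryDist Ω z ≤ x := by rw [hpd']; exact infDist_le_dist_of_mem hp'.1
      have h2 := hest z (hsub hz) (h1.trans_lt hxε)
      have h3 : (-log (bdryDist Ω z)) ^ (-σ) ≤ (-log x) ^ (-σ) :=
        rpow_le_rpow_of_nonpos (by linarith)
          (neg_le_neg (log_le_log (bdryDist_pos hΩ hne hz.1) h1)) (by linarith)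
      have h4 := mul_le_mul_of_nonneg_left h3 hC.le
      have h5 := le_max_left (φ z) (‖z - a‖ ^ 2 + -r ^ 2)
      nlinarith
    · have h1 : dist p a = r := by
        have := frontier_ball_subset_sphere hp'.2
        exact this
      have h2 : r - ‖z - a‖ ≤ x := by
        have := dist_triangle p z a
        rw [hpd', dist_comm z p, ← dist_eq_norm]
        linarith
      have h3 := mul_le_const_mul_neg_log_rpow hσ hd0 hx1
      have h4 := le_max_right (φ z) (‖z - a‖ ^ 2 + -r ^ 2)
      have h5 := mem_ball_iff_norm.1 hz.2
      have h6 : r ^ 2 - ‖z - a‖ ^ 2 ≤ 2 * r * x := by nlinarith [norm_nonneg (z - a)]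
      have h7 := mul_le_mul_of_nonneg_left h3 (by positivity : 0 ≤ 2 * r)
      nlinarith

/-! ### From local to global -/

lemma ContPSHOn.fold_max {ι : Type*} (s : Finset ι) {N : Set (Cn n)} {f : ι → Cn n → ℝ} (m : ℝ)
    (hf : ∀ j ∈ s, ContPSHOn (f j) N) :
    ContPSHOn (fun z => s.fold Max.max m fun j => f j z) N := by
  classical
  induction s using Finset.induction_on with
  | empty => simpa using ContPSHOn.const m
  | insert i s hi ih =>
    simp only [Finset.fold_insert hi]
    exact (hf i (by simp)).max (ih fun j hj => hf j (by simp [hj]))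

open scoped Classical in
/-- Gluing finitely many plurisubharmonic functions `f j` on `Ω ∩ B j` and a constant by taking
maxima, if near `∂(B j)` the function `f j` does not contribute to the maximum. -/
lemma contPSHOn_glue_fold {ι : Type*} (s : Finset ι) {Ω : Set (Cn n)} (hΩ : IsOpen Ω)
    {B : ι → Set (Cn n)} (hB : ∀ j ∈ s, IsOpen (B j)) {f : ι → Cn n → ℝ} {m : ℝ}
    (hf : ∀ j ∈ s, ContPSHOn (f j) (Ω ∩ B j))
    (h : ∀ z ∈ Ω, ∀ j ∈ s, z ∉ B j → ∀ᶠ y in nhds z, y ∈ Ω → y ∈ B j →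
      f j y ≤ m ∨ ∃ i ∈ s, z ∈ B i ∧ f j y ≤ f i y) :
    ContPSHOn (fun z => (s.filter fun j => z ∈ B j).fold max m fun j => f j z) Ω := by
  refine contPSHOn_of_locally_eq fun z hz => ?_
  have h1 : ∀ᶠ y in nhds z, ∀ j ∈ s, z ∈ B j → y ∈ B j := by
    refine (Filter.eventually_all_finset s).2 fun j hj => ?_
    by_cases hzj : z ∈ B j
    · filter_upwards [(hB j hj).mem_nhds hzj] with y hy _ using hy
    · exact Filter.Eventually.of_forall fun y h => absurd h hzj
  have h2 : ∀ᶠ y in nhds z, ∀ j ∈ s, z ∉ B j → y ∈ Ω → y ∈ B j →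
      f j y ≤ m ∨ ∃ i ∈ s, z ∈ B i ∧ f j y ≤ f i y := by
    refine (Filter.eventually_all_finset s).2 fun j hj => ?_
    by_cases hzj : z ∈ B j
    · exact Filter.Eventually.of_forall fun y h => absurd hzj h
    · filter_upwards [h z hz j hj hzj] with y hy _ using hy
  obtain ⟨N, hN, hNo, hzN⟩ := _root_.eventually_nhds_iff.1 ((h1.and h2).and (hΩ.mem_nhds hz))
  refine ⟨N, fun y => (s.filter fun j => z ∈ B j).fold max m fun j => f j y, hNo, hzN,
    fun y hy => (hN y hy).2, ContPSHOn.fold_max _ _ fun j hj => ?_, fun y hy => ?_⟩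
  · rw [Finset.mem_filter] at hj
    exact (hf j hj.1).mono fun y hy => ⟨(hN y hy).2, (hN y hy).1.1 j hj.1 hj.2⟩
  · obtain ⟨⟨hy1, hy2⟩, hyΩ⟩ := hN y hy
    refine le_antisymm (Finset.fold_max_le _ |>.2 ⟨Finset.le_fold_max _ |>.2 (Or.inl le_rfl),
      fun j hj => ?_⟩) (Finset.fold_max_le _ |>.2 ⟨Finset.le_fold_max _ |>.2 (Or.inl le_rfl),
      fun j hj => ?_⟩)
    · rw [Finset.mem_filter] at hj
      rw [Finset.le_fold_max]
      by_cases hzj : z ∈ B j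
      · exact Or.inr ⟨j, by simp [hj.1, hzj], le_rfl⟩
      · rcases hy2 j hj.1 hzj hyΩ hj.2 with h3 | ⟨i, hi, hzi, h3⟩
        · exact Or.inl h3
        · exact Or.inr ⟨i, by simp [hi, hzi], h3⟩
    · rw [Finset.mem_filter] at hj
      rw [Finset.le_fold_max]
      exact Or.inr ⟨j, by simp [hj.1, hy1 j hj.1 hj.2], le_rfl⟩

lemma exists_pos_forall_mem_finset {ι : Type*} (s : Finset ι) {P : ι → ℝ → Prop}
    (hP : ∀ i c c', c' ≤ c → P i c → P i c') (h : ∀ i ∈ s, ∃ c > 0, P i c) :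
    ∃ c > 0, ∀ i ∈ s, P i c := by
  classical
  induction s using Finset.induction_on with
  | empty => exact ⟨1, one_pos, by simp⟩
  | insert i s hi ih =>
    obtain ⟨c, hc, h1⟩ := ih fun j hj => h j (by simp [hj])
    obtain ⟨c', hc', h2⟩ := h i (by simp)
    refine ⟨min c c', lt_min hc hc', fun j hj => ?_⟩
    rcases Finset.mem_insert.1 hj with rfl | hj
    · exact hP _ _ _ (min_le_right _ _) h2
    · exact hP _ _ _ (min_le_left _ _) (h1 j hj)

/-- The deficits (1/2) ^ (k + 1) have total less than 1. -/
lemma sub_one_le_sum_of_near_one {η h : ℕ → ℝ} (hη : Antitone η) {d : ℝ}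
    (hb : ∀ k, d < η (k + 1) → 1 - (1 / 2) ^ (k + 1) ≤ h k) {N : ℕ} (hd : d < η N) :
    (N : ℝ) - 1 ≤ ∑ k ∈ Finset.range N, h k := by
  have key : ∀ N, d < η N → (N : ℝ) - 1 + (1 / 2) ^ N ≤ ∑ k ∈ Finset.range N, h k := by
    intro N
    induction N with
    | zero => intro _; simp
    | succ N ih =>
      intro hd
      have h1 := ih (hd.trans_le (hη (Nat.le_succ N)))
      have h2 := hb N hd
      rw [Finset.sum_range_succ]
      push_cast
      rw [pow_succ] at h2 ⊢
      linarith
  have := key N hd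
  have h2 : (0 : ℝ) < (1 / 2) ^ N := by positivity
  linarith

/-- At depth d, terms with η k ≤ d vanish in the first sum and terms with d < η (k + 1) are nearly 1
in the second. At most one index lies between, so that index and the summable deficits cost at most
2, independently of N. -/
lemma sum_le_sum_add_two {η h h' : ℕ → ℝ} (hη : Antitone η) {d : ℝ}
    (ha : ∀ k, η k ≤ d → h k = 0) (h0 : ∀ k, 0 ≤ h' k) (h1 : ∀ k, h k ≤ 1)
    (hb : ∀ k, d < η (k + 1) → 1 - (1 / 2) ^ (k + 1) ≤ h' k) (N : ℕ) :
    ∑ k ∈ Finset.range N, h k ≤ ∑ k ∈ Finset.range N, h' k + 2 := by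
  induction N with
  | zero => simp
  | succ N ih =>
    rw [Finset.sum_range_succ, Finset.sum_range_succ]
    rcases le_or_gt (η N) d with hd | hd
    · linarith [ha N hd, h0 N]
    · have h2 := sub_one_le_sum_of_near_one hη hb hd
      have h3 : ∑ k ∈ Finset.range N, h k ≤ N := by
        simpa using Finset.sum_le_card_nsmul (Finset.range N) h 1 fun k _ => h1 k
      linarith [h1 N, h0 N]

lemma mem_of_mem_closure_of_bdryDist_pos {Ω : Set (Cn n)} (hΩ : IsOpen Ω) {z : Cn n}
    (hz : z ∈ closure Ω) (hd : 0 < bdryDist Ω z) : z ∈ Ω := by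
  by_contra h
  have h1 : z ∈ frontier Ω := by rw [hΩ.frontier_eq]; exact ⟨hz, h⟩
  have h2 : bdryDist Ω z = 0 := infDist_zero_of_mem h1
  linarith

lemma isCompact_closure_inter_bdryDist_ge {Ω : Set (Cn n)} (hb : Bornology.IsBounded Ω) (η : ℝ) :
    IsCompact (closure Ω ∩ {z | η ≤ bdryDist Ω z}) :=
  Metric.isCompact_of_isClosed_isBounded
    (isClosed_closure.inter (isClosed_le continuous_const (continuous_bdryDist Ω)))
    (hb.closure.subset Set.inter_subset_left)

/-- Halving the radius makes the relevant closed set a compact subset of the domain of φ, where the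
negative continuous function attains its maximum. -/
lemma exists_neg_upper_bound {Ω : Set (Cn n)} (hΩ : IsOpen Ω) (hb : Bornology.IsBounded Ω)
    {a : Cn n} {R : ℝ} (hR : 0 < R) {φ : Cn n → ℝ} (hφ : ContinuousOn φ (Ω ∩ ball a R))
    (hφ0 : ∀ z ∈ Ω ∩ ball a R, φ z < 0) {η : ℝ} (hη : 0 < η) :
    ∃ c > 0, ∀ z ∈ Ω ∩ ball a (R / 2), η ≤ bdryDist Ω z → φ z ≤ -c := by
  set S := closure Ω ∩ {z | η ≤ bdryDist Ω z} ∩ closedBall a (R / 2)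
  have hS : IsCompact S := (isCompact_closure_inter_bdryDist_ge hb η).inter_right isClosed_closedBall
  have hsub : S ⊆ Ω ∩ ball a R := fun z hz =>
    ⟨mem_of_mem_closure_of_bdryDist_pos hΩ hz.1.1 (hη.trans_le hz.1.2),
      closedBall_subset_ball (by linarith) hz.2⟩
  have hmem : ∀ z ∈ Ω ∩ ball a (R / 2), η ≤ bdryDist Ω z → z ∈ S := fun z hz h =>
    ⟨⟨subset_closure hz.1, h⟩, ball_subset_closedBall hz.2⟩
  rcases S.eq_empty_or_nonempty with he | hne
  · exact ⟨1, one_pos, fun z hz h => absurd (hmem z hz h) (by simp [he])⟩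
  · obtain ⟨z₀, hz₀, hmax⟩ := hS.exists_isMaxOn hne (hφ.mono hsub)
    refine ⟨-φ z₀, neg_pos.2 (hφ0 z₀ (hsub hz₀)), fun z hz h => ?_⟩
    rw [neg_neg]
    exact hmax (hmem z hz h)

/-- If near each boundary point there is a negative plurisubharmonic function tending to zero at
the boundary, then there are global negative plurisubharmonic functions which are `≤ -1` on a given
compact set and `≥ -1/2` near the boundary. -/
theorem exists_psh_separating {Ω : Set (Cn n)} (hΩ : IsOpen Ω) (hb : Bornology.IsBounded Ω)
    (hne : (frontier Ω).Nonempty)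
    (hloc : ∀ a ∈ frontier Ω, ∃ R > 0, ∃ φ : Cn n → ℝ, ContPSHOn φ (Ω ∩ ball a R) ∧
      (∀ z ∈ Ω ∩ ball a R, φ z < 0) ∧
      ∀ e > 0, ∃ η > 0, ∀ z ∈ Ω ∩ ball a R, bdryDist Ω z < η → -e ≤ φ z) :
    ∃ t₀ > 0, ∀ t, 0 < t ∧ t < t₀ → ∃ (t' : ℝ) (u : Cn n → ℝ), 0 < t' ∧ t' ≤ t / 2 ∧
      ContPSHOn u Ω ∧ (∀ z ∈ Ω, u z < 0) ∧ (∀ z ∈ Ω, t ≤ bdryDist Ω z → u z ≤ -1) ∧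
      ∀ z ∈ Ω, bdryDist Ω z ≤ t' → -(1 / 2) ≤ u z := by
  classical
  have hloc' : ∀ a ∈ frontier Ω, ∃ (R : ℝ) (φ : Cn n → ℝ), 0 < R ∧ R ≤ 1 ∧
      ContPSHOn φ (Ω ∩ ball a R) ∧ (∀ z ∈ Ω ∩ ball a R, φ z < 0) ∧
      ∀ e > 0, ∃ η > 0, ∀ z ∈ Ω ∩ ball a R, bdryDist Ω z < η → -e ≤ φ z := by
    intro a ha
    obtain ⟨R, hR, φ, h1, h2, h3⟩ := hloc a ha
    have hsub : Ω ∩ ball a (min R 1) ⊆ Ω ∩ ball a R :=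
      Set.inter_subset_inter_right _ (ball_subset_ball (min_le_left _ _))
    refine ⟨min R 1, φ, by positivity, min_le_right _ _, h1.mono hsub, fun z hz => h2 z (hsub hz),
      fun e he => ?_⟩
    obtain ⟨η, hη, h4⟩ := h3 e he
    exact ⟨η, hη, fun z hz => h4 z (hsub hz)⟩
  choose! R φ hR hR1 hφ hφ0 hφlim using hloc'
  have hcpt : IsCompact (frontier Ω) := Metric.isCompact_of_isClosed_isBounded isClosed_frontier
    (hb.closure.subset frontier_subset_closure)
  obtain ⟨s, hs, hcov⟩ := hcpt.elim_nhds_subcover (fun a => ball a (R a / 4))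
    fun a ha => ball_mem_nhds a (by linarith [hR a ha])
  obtain ⟨t₀, ht₀, hthick⟩ := hcpt.exists_thickening_subset_open
    (isOpen_biUnion fun a _ => isOpen_ball) hcov
  have hcov' : ∀ z, bdryDist Ω z < t₀ → ∃ a ∈ s, z ∈ ball a (R a / 4) := fun z hz => by
    have h1 : z ∈ thickening t₀ (frontier Ω) := by
      rw [mem_thickening_iff_infDist_lt hne]; exact hz
    simpa using hthick h1
  obtain ⟨κ, hκ, hκR⟩ := exists_pos_forall_mem_finset s (P := fun a c => c ≤ (R a) ^ 2 / 8)
    (fun _ _ _ h h' => h.trans h') fun a ha =>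
      ⟨R a ^ 2 / 8, by have := hR a (hs a ha); positivity, le_rfl⟩
  have hUp : ∀ η, 0 < η → ∃ c > 0, ∀ a ∈ s, ∀ z ∈ Ω ∩ ball a (R a / 2), η ≤ bdryDist Ω z →
      φ a z ≤ -c := fun η hη =>
    exists_pos_forall_mem_finset s (fun a c c' h h' z hz hd => (h' z hz hd).trans (neg_le_neg h))
      fun a ha => exists_neg_upper_bound hΩ hb (hR a (hs a ha)) (hφ a (hs a ha)).1
        (hφ0 a (hs a ha)) hη
  have hLow : ∀ e, 0 < e → ∃ η > 0, ∀ a ∈ s, ∀ z ∈ Ω ∩ ball a (R a), bdryDist Ω z < η →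
      -e ≤ φ a z := fun e he =>
    exists_pos_forall_mem_finset s (fun a c c' h h' z hz hd => h' z hz (hd.trans_le h))
      fun a ha => hφlim a (hs a ha) e he
  choose! c hc0 hc using hUp
  choose! E hE0 hE using hLow
  obtain ⟨K, hK, hKκ⟩ : ∃ K : ℝ, 0 < K ∧ 2 ≤ K * κ :=
    ⟨2 / κ, by positivity, by rw [div_mul_cancel₀ _ hκ.ne']⟩
  obtain ⟨Q, hQ⟩ := hb.exists_norm_le
  set m : ℝ := K * (Q ^ 2 + 1) with hm
  have hm0 : 0 ≤ m := by positivity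
  -- The power of y with respect to the sphere of radius R a / 4: negative on the covering ball,
  -- above R a ^ 2 / 8 outside the ball of radius R a / 2. Moreover ‖y‖² - pw a y is real affine in
  -- y, so adding it preserves plurisubharmonicity.
  let pw : Cn n → Cn n → ℝ := fun a y => ‖y - a‖ ^ 2 - (R a / 4) ^ 2
  have hpw : ∀ a y, 2 * (inner ℂ a y).re + (-‖a‖ ^ 2 + (R a / 4) ^ 2) = ‖y‖ ^ 2 - pw a y := by
    intro a y
    have h1 : (inner ℂ a y).re = (inner ℂ y a).re := inner_re_symm (𝕜 := ℂ) a y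
    simp only [pw]
    rw [@norm_sub_sq ℂ, h1]
    simp only [RCLike.re_to_complex]
    ring
  have hpwc : ∀ a, Continuous (pw a) := fun a => by simp only [pw]; fun_prop
  have hpwm : ∀ a ∈ s, ∀ y ∈ Ω, K * (‖y‖ ^ 2 - pw a y) ≤ m := by
    intro a ha y hy
    have h1 := hQ y hy
    have h2 := hR a (hs a ha)
    have h3 := hR1 a (hs a ha)
    refine mul_le_mul_of_nonneg_left ?_ hK.le
    have h4 : ‖y‖ ^ 2 ≤ Q ^ 2 := pow_le_pow_left₀ (norm_nonneg y) h1 2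
    have h5 : (R a / 4) ^ 2 ≤ 1 := by nlinarith
    simp only [pw]
    nlinarith [sq_nonneg ‖y - a‖]
  refine ⟨t₀, ht₀, fun t ⟨ht, htt₀⟩ => ?_⟩
  -- The depths are chosen recursively: every φ a is ≤ -c (η k) at depth ≥ η k, and below η (k + 1)
  -- it is at least -(1/2) ^ (k + 1) times c (η k). All constants are uniform over the finite cover.
  let η : ℕ → ℝ := fun k => Nat.rec t (fun k x => min (x / 2) (E ((1 / 2) ^ (k + 1) * c x))) k
  have hηs : ∀ k, η (k + 1) = min (η k / 2) (E ((1 / 2) ^ (k + 1) * c (η k))) := fun k => rfl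
  have hη0 : ∀ k, 0 < η k := by
    intro k
    induction k with
    | zero => exact ht
    | succ k ih =>
      rw [hηs]
      have h1 := hc0 _ ih
      exact lt_min (by linarith) (hE0 _ (by positivity))
  have hηh : ∀ k, η (k + 1) ≤ η k / 2 := fun k => by rw [hηs]; exact min_le_left _ _
  have hηa : Antitone η := antitone_nat_of_succ_le fun k => by linarith [hηh k, hη0 k]
  let h : Cn n → ℕ → Cn n → ℝ := fun a k z => max 0 ((c (η k))⁻¹ * φ a z + 1)
  have hsub : ∀ a ∈ s, Ω ∩ ball a (R a / 2) ⊆ Ω ∩ ball a (R a) := fun a ha =>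
    Set.inter_subset_inter_right _ (ball_subset_ball (by linarith [hR a (hs a ha)]))
  have hz0 : ∀ a ∈ s, ∀ z ∈ Ω ∩ ball a (R a / 2), ∀ k, η k ≤ bdryDist Ω z → h a k z = 0 := by
    intro a ha z hz k hd
    have h1 := hc _ (hη0 k) a ha z hz hd
    have h2 := hc0 _ (hη0 k)
    refine max_eq_left ?_
    have : (c (η k))⁻¹ * φ a z ≤ -1 := (inv_mul_le_iff₀ h2).2 (by linarith)
    linarith
  have hle1 : ∀ a ∈ s, ∀ z ∈ Ω ∩ ball a (R a / 2), ∀ k, h a k z ≤ 1 := by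
    intro a ha z hz k
    refine max_le zero_le_one ?_
    have := mul_neg_of_pos_of_neg (inv_pos.2 (hc0 _ (hη0 k))) (hφ0 a (hs a ha) z (hsub a ha hz))
    linarith
  have hnear : ∀ a ∈ s, ∀ z ∈ Ω ∩ ball a (R a / 2), ∀ k, bdryDist Ω z < η (k + 1) →
      1 - (1 / 2) ^ (k + 1) ≤ h a k z := by
    intro a ha z hz k hd
    have h2 := hc0 _ (hη0 k)
    have h1 := hE ((1 / 2) ^ (k + 1) * c (η k)) (by positivity) a ha z (hsub a ha hz)
      (hd.trans_le (by rw [hηs]; exact min_le_right _ _))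
    refine le_trans ?_ (le_max_right _ _)
    have : -(1 / 2) ^ (k + 1) ≤ (c (η k))⁻¹ * φ a z := (le_inv_mul_iff₀ h2).2 (by linarith)
    linarith
  have hnn : ∀ a k z, 0 ≤ h a k z := fun a k z => le_max_left _ _
  -- This makes (m + 2) / (N + 1) ≤ 1/2, the value needed at the end, where U ≥ N - 1.
  obtain ⟨N, hN⟩ := exists_nat_ge (2 * m + 3)
  let f : Cn n → Cn n → ℝ := fun a z => ∑ k ∈ Finset.range N, h a k z +
    K * (2 * (inner ℂ a z).re + (-‖a‖ ^ 2 + (R a / 4) ^ 2))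
  have hfeq : ∀ a z, f a z = ∑ k ∈ Finset.range N, h a k z + K * (‖z‖ ^ 2 - pw a z) :=
    fun a z => by simp only [f, hpw]
  have hfpsh : ∀ a ∈ s, ContPSHOn (f a) (Ω ∩ ball a (R a / 2)) := fun a ha => by
    refine (ContPSHOn.sum _ fun k _ => ?_).add
      ((((contPSHOn_re_inner a _).const_mul zero_le_two).add (ContPSHOn.const _)).const_mul hK.le)
    exact (ContPSHOn.const 0).max (((((hφ a (hs a ha)).mono (hsub a ha)).const_mul
      (inv_pos.2 (hc0 _ (hη0 k))).le)).add (ContPSHOn.const 1))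
  have hf0 : ∀ a ∈ s, ∀ z ∈ Ω ∩ ball a (R a / 2), t ≤ bdryDist Ω z → f a z ≤ m := by
    intro a ha z hz hd
    rw [hfeq, Finset.sum_eq_zero fun k _ => hz0 a ha z hz k ((hηa (Nat.zero_le k)).trans hd),
      zero_add]
    exact hpwm a ha z hz.1
  let U : Cn n → ℝ := fun z => (s.filter fun a => z ∈ ball a (R a / 2)).fold max m fun a => f a z
  have hU : ContPSHOn U Ω := by
    refine contPSHOn_glue_fold s hΩ (fun a _ => isOpen_ball) hfpsh fun z hz j hj hzj => ?_
    rcases lt_or_ge t (bdryDist Ω z) with hd | hd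
    · filter_upwards [(isOpen_lt continuous_const (continuous_bdryDist Ω)).mem_nhds hd] with y hy
        hyΩ hyj
      exact Or.inl (hf0 j hj y ⟨hyΩ, hyj⟩ (le_of_lt hy))
    -- Some i has z in its quarter ball, while z is outside the half ball of j. The affine terms
    -- then favour i by K κ ≥ 2, which beats the discrepancy between the two sums.
    · obtain ⟨i, hi, hzi⟩ := hcov' z (hd.trans_lt htt₀)
      have hRi := hR i (hs i hi)
      have hRj := hR j (hs j hj)
      have hzi' : z ∈ ball i (R i / 2) := ball_subset_ball (by linarith) hzi
      have e1 : pw i z < 0 := by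
        have := mem_ball_iff_norm.1 hzi
        simp only [pw]
        nlinarith [norm_nonneg (z - i)]
      have e2 : R j ^ 2 / 8 < pw j z := by
        have : R j / 2 ≤ ‖z - j‖ := by rw [← dist_eq_norm]; simpa using hzj
        simp only [pw]
        nlinarith [norm_nonneg (z - j)]
      filter_upwards [(isOpen_lt (hpwc i) continuous_const).mem_nhds e1,
        (isOpen_lt continuous_const (hpwc j)).mem_nhds e2, isOpen_ball.mem_nhds hzi']
        with y hy1 hy2 hyi hyΩ hyj
      refine Or.inr ⟨i, hi, hzi', ?_⟩
      rw [hfeq, hfeq]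
      have e3 := sum_le_sum_add_two hηa (fun k => hz0 j hj y ⟨hyΩ, hyj⟩ k) (fun k => hnn i k y)
        (fun k => hle1 j hj y ⟨hyΩ, hyj⟩ k) (fun k => hnear i hi y ⟨hyΩ, hyi⟩ k) N
      have e4 : κ ≤ pw j y - pw i y := by
        have h1 : pw i y < 0 := hy1
        have h2 : R j ^ 2 / 8 < pw j y := hy2
        linarith [hκR j hj]
      have e5 := mul_le_mul_of_nonneg_left e4 hK.le
      linarith
  have hUle : ∀ z ∈ Ω, U z ≤ N + m := by
    intro z hz
    refine (Finset.fold_max_le _).2 ⟨by linarith [Nat.cast_nonneg (α := ℝ) N], fun a ha => ?_⟩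
    rw [Finset.mem_filter] at ha
    rw [hfeq]
    have h1 : ∑ k ∈ Finset.range N, h a k z ≤ N := by
      simpa using Finset.sum_le_card_nsmul (Finset.range N) (fun k => h a k z) 1
        fun k _ => hle1 a ha.1 z ⟨hz, ha.2⟩ k
    linarith [hpwm a ha.1 z hz]
  have hN1 : (0 : ℝ) < N + 1 := by positivity
  refine ⟨η (N + 1), fun z => ((N : ℝ) + 1)⁻¹ * (U z + -(N + m + 1)), hη0 (N + 1), ?_,
    (hU.add (ContPSHOn.const _)).const_mul (inv_pos.2 hN1).le,
    fun z hz => mul_neg_of_pos_of_neg (inv_pos.2 hN1) (by linarith [hUle z hz]),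
    fun z hz hd => ?_, fun z hz hd => ?_⟩
  · exact (hηa (show 1 ≤ N + 1 by lia)).trans (hηh 0)
  · rw [inv_mul_le_iff₀ hN1]
    have : U z ≤ m := (Finset.fold_max_le _).2 ⟨le_rfl, fun a ha => by
      rw [Finset.mem_filter] at ha
      exact hf0 a ha.1 z ⟨hz, ha.2⟩ hd⟩
    linarith
  · rw [le_inv_mul_iff₀ hN1]
    have hdN : bdryDist Ω z < η N := by linarith [hηh N, hη0 N]
    have hdt : bdryDist Ω z < t₀ := hdN.trans_le ((hηa (Nat.zero_le N)).trans htt₀.le)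
    obtain ⟨a, ha, hza⟩ := hcov' z hdt
    have hza' : z ∈ ball a (R a / 2) := ball_subset_ball (by linarith [hR a (hs a ha)]) hza
    have h1 := sub_one_le_sum_of_near_one hηa (fun k => hnear a ha z ⟨hz, hza'⟩ k) hdN
    have h2 : pw a z < 0 := by
      have := mem_ball_iff_norm.1 hza
      simp only [pw]
      nlinarith [norm_nonneg (z - a)]
    have h3 : 0 ≤ K * (‖z‖ ^ 2 - pw a z) := mul_nonneg hK.le (by nlinarith [sq_nonneg ‖z‖])
    have h4 : (N : ℝ) - 1 ≤ U z := (Finset.le_fold_max _).2 (Or.inr ⟨a, Finset.mem_filter.2 ⟨ha, hza'⟩, by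
      rw [hfeq]; linarith⟩)
    linarith

/-- A bounded open set that admits, near each boundary point, a negative plurisubharmonic
function tending to zero at the boundary is hyperconvex. -/
theorem isHyperconvex_of_local {Ω : Set (Cn n)} (hΩ : IsOpen Ω) (hb : Bornology.IsBounded Ω)
    (hne : (frontier Ω).Nonempty)
    (hloc : ∀ a ∈ frontier Ω, ∃ R > 0, ∃ φ : Cn n → ℝ, ContPSHOn φ (Ω ∩ ball a R) ∧
      (∀ z ∈ Ω ∩ ball a R, φ z < 0) ∧
      ∀ e > 0, ∃ η > 0, ∀ z ∈ Ω ∩ ball a R, bdryDist Ω z < η → -e ≤ φ z) :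
    IsHyperconvex Ω := by
  obtain ⟨t₀, ht₀, H⟩ := exists_psh_separating hΩ hb hne hloc
  choose! T u hT0 hTh hu hu0 hup hlow using H
  let t : ℕ → ℝ := fun k => T^[k] (t₀ / 2)
  have hts : ∀ k, t (k + 1) = T (t k) := fun k => Function.iterate_succ_apply' T k _
  have ht : ∀ k, 0 < t k ∧ t k < t₀ := by
    intro k
    induction k with
    | zero => exact ⟨by simp only [t, Function.iterate_zero, id]; linarith,
        by simp only [t, Function.iterate_zero, id]; linarith⟩
    | succ k ih =>
      rw [hts]
      exact ⟨hT0 _ ih, by linarith [hTh _ ih, ih.1, ih.2]⟩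
  have hth : ∀ k, t (k + 1) ≤ t k / 2 := fun k => by rw [hts]; exact hTh _ (ht k)
  have htle : ∀ k, t k ≤ t₀ / 2 * (1 / 2) ^ k := by
    intro k
    induction k with
    | zero => simp [t]
    | succ k ih => rw [pow_succ]; linarith [hth k]
  have ht0 : Filter.Tendsto t Filter.atTop (nhds 0) := by
    refine squeeze_zero (fun k => (ht k).1.le) htle ?_
    simpa using (tendsto_pow_atTop_nhds_zero_of_lt_one (r := (1 / 2 : ℝ)) (by norm_num)
      (by norm_num)).const_mul (t₀ / 2)
  obtain ⟨ρ, hρ, hρ0, hρlow⟩ := exists_psh_of_levels hΩ (continuous_bdryDist Ω)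
    (fun z hz => bdryDist_pos hΩ hne hz)
    (antitone_nat_of_succ_le fun k => by linarith [hth k, (ht k).1]) ht0
    (u := fun k => u (t k)) (q := 1 / 2) (by norm_num) (fun k => hu _ (ht k))
    (fun k => hu0 _ (ht k)) (fun k => hup _ (ht k))
    (fun k z hz h => hlow _ (ht k) z hz (by rw [← hts]; exact h))
  refine ⟨ρ, hρ, hρ0, fun c hc => ?_⟩
  obtain ⟨k, hk⟩ := exists_pow_lt_of_lt_one hc (by norm_num : (1 / 2 : ℝ) < 1)
  have hcpt := isCompact_closure_inter_bdryDist_ge hb (t (k + 1))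
  have hsub : closure {z ∈ Ω | ρ z < -c} ⊆ closure Ω ∩ {z | t (k + 1) ≤ bdryDist Ω z} := by
    refine closure_minimal (fun z hz => ⟨subset_closure hz.1, ?_⟩) hcpt.isClosed
    by_contra hcon
    have h1 := hρlow k z hz.1 (not_le.1 hcon).le
    have h2 : ((1 : ℝ) / 2) ^ (k + 1) ≤ (1 / 2) ^ k :=
      pow_le_pow_of_le_one (by norm_num) (by norm_num) (Nat.le_succ k)
    linarith [hz.2]
  exact ⟨hcpt.of_isClosed_subset isClosed_closure hsub, fun z hz =>
    mem_of_mem_closure_of_bdryDist_pos hΩ (hsub hz).1 ((ht _).1.trans_le (hsub hz).2)⟩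

/-- For nonempty Ω this occurs only in dimension 0. There `bdryDist` takes its default value 0 and
carries no information, but Ω is itself compact. -/
lemma isHyperconvex_of_frontier_eq_empty {Ω : Set (Cn n)} (hb : Bornology.IsBounded Ω)
    (h : frontier Ω = ∅) : IsHyperconvex Ω := by
  have hcl : IsClosed Ω := (isClopen_iff_frontier_eq_empty.2 h).1
  refine ⟨fun _ => -1, ContPSHOn.const _, fun _ _ => by norm_num, fun c _ => ?_⟩
  have hsub : closure {z ∈ Ω | (-1 : ℝ) < -c} ⊆ Ω := closure_minimal (fun z hz => hz.1) hcl
  exact ⟨(Metric.isCompact_of_isClosed_isBounded hcl hb).of_isClosed_subset isClosed_closure hsub,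
    hsub⟩

theorem isHyperconvex_of_hasHolderBoundary {Ω : Set (Cn n)} (hΩ : IsOpen Ω)
    (hb : Bornology.IsBounded Ω) (hpsc : IsPseudoconvex Ω) (hbd : HasHolderBoundary Ω) :
    IsHyperconvex Ω := by
  rcases (frontier Ω).eq_empty_or_nonempty with h | hne
  · exact isHyperconvex_of_frontier_eq_empty hb h
  refine isHyperconvex_of_local hΩ hb hne fun a ha => ?_
  obtain ⟨β, hβ, hβ1, hg⟩ := hbd a ha
  have hβ' : (0 : ℝ) < β := hβ
  obtain ⟨R, hR, H⟩ := exists_local_psh hΩ hpsc ha hβ hβ1 hg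
  -- Any positive admissible exponent gives convergence to zero; τ = β is admissible because β (1 -
  -- β) < β.
  obtain ⟨φ, hφ, hφ0, C, ε, hC, hε, -, hest⟩ := H β hβ' (by nlinarith)
  refine ⟨R, hR, φ, hφ, hφ0, fun e he => ?_⟩
  refine ⟨min ε (exp (-(C / e) ^ (β : ℝ)⁻¹)), by positivity, fun z hz hd => ?_⟩
  have h1 := hest z hz (hd.trans_le (min_le_left _ _))
  have h2 := (log_lt_iff_lt_exp (bdryDist_pos hΩ hne hz.1)).2 (hd.trans_le (min_le_right _ _))
  have h3 : (-log (bdryDist Ω z)) ^ (-(β : ℝ)) ≤ ((C / e) ^ (β : ℝ)⁻¹) ^ (-(β : ℝ)) :=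
    rpow_le_rpow_of_nonpos (by positivity) (by linarith) (by linarith)
  rw [← rpow_mul (by positivity), mul_neg, inv_mul_cancel₀ hβ'.ne', rpow_neg_one, inv_div] at h3
  have h4 := mul_le_mul_of_nonneg_left h3 hC.le
  rw [mul_div_cancel₀ _ hC.ne'] at h4
  linarith

end HolderHyperconvex

end

/-- A bounded pseudoconvex domain with Hölder boundary is hyperconvex; moreover, near a boundary
point where the boundary is a graph of Hölder order `β`, the intersections of `Ω` with small
balls carry, for every `τ < β / (1 - β)` (every `τ` if `β = 1`), a negative continuous psh
function `ρ` with `-ρ ≤ C (-log δ) ^ (-τ)` near the boundary. -/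
theorem theorem1p1 {n : ℕ} (Ω : Set (HolderHyperconvex.Cn n))
    (hΩ : HolderHyperconvex.IsBoundedDomain Ω)
    (hpsc : HolderHyperconvex.IsPseudoconvex Ω)
    (hbd : HolderHyperconvex.HasHolderBoundary Ω) :
    HolderHyperconvex.IsHyperconvex Ω ∧
    ∀ a ∈ frontier Ω, ∀ β : NNReal, 0 < β → β ≤ 1 → HolderHyperconvex.IsHolderGraphAt Ω a β →
      ∃ R : ℝ, 0 < R ∧ ∀ r : ℝ, 0 < r → r < R →
        ∀ τ : ℝ, τ * (1 - (β : ℝ)) < (β : ℝ) →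
          ∃ ρ : HolderHyperconvex.Cn n → ℝ,
            HolderHyperconvex.ContPSHOn ρ (Ω ∩ Metric.ball a r) ∧
            (∀ z ∈ Ω ∩ Metric.ball a r, ρ z < 0) ∧
            ∃ C ε : ℝ, 0 < C ∧ 0 < ε ∧ ε < 1 ∧
              ∀ z ∈ Ω ∩ Metric.ball a r,
                HolderHyperconvex.bdryDist (Ω ∩ Metric.ball a r) z < ε →
                -ρ z ≤ C *
                  (-Real.log (HolderHyperconvex.bdryDist (Ω ∩ Metric.ball a r) z)) ^ (-τ) := by
  refine ⟨HolderHyperconvex.isHyperconvex_of_hasHolderBoundary hΩ.1 hΩ.2.2 hpsc hbd,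
    fun a ha β hβ hβ1 hg => ?_⟩
  exact HolderHyperconvex.exists_psh_inter_ball hΩ.1 hpsc ha hβ hβ1 hg
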